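/- Let $n\ge 1$, let $(M,g)$ be a smooth Riemannian manifold without boundary, and let $S^n\subset\mathbb{R}^{n+1}$ be the unit sphere with its round metric, Levi-Civita connection $\nabla$ and curvature tensor $R(X,Y)=\nabla_{[X,Y]}-[\nabla_X,\nabla_Y]$. For a smooth map $\phi:M\to S^n$ let $\nabla^\phi$ be the pull-back connection on $\phi^{-1}TS^n$; traces are taken with respect to $g$. The map $\phi$ is *harmonic* if $\operatorname{trace}\nabla d\phi=0$, and a *harmonic morphism* if for every open $U\subseteq S^n$ and every harmonic function $f$ on $U$ the function $f\circ\phi$ is harmonic on $\phi^{-1}(U)$. For a smooth section $V$ of $\phi^{-1}TS^n$ put $$J^\phi V=-\operatorname{trace}\nabla^2V-\operatorname{trace}R(d\phi,V)d\phi,\qquad \nabla^2_{X,Y}V=\nabla^\phi_X\nabla^\phi_YV-\nabla^\phi_{\nabla^M_XY}V,$$ $$K(\phi)=\{V:\ J^\phi V=0,\ \operatorname{trace}\langle d\phi,\nabla^\phi V\rangle=0\}.$$ The section $V$ is *projectable* if $\phi(x)=\phi(x')$ implies $V(x)=V(x')$, and a *harmonic variation* of $\phi$ if $\exp(tV):M\to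 S^n$, $x\mapsto\exp_{\phi(x)}(tV(x))$, is a harmonic map for every $t\in\mathbb{R}$. A harmonic map $\phi:M\to S^n$ is *infinitesimally rigid* if for every projectable $V\in K(\phi)$ there is $X\in so(n+1)$ (regarded as the vector field $p\mapsto Xp$ on $S^n$) with $V=X\circ\phi$; it is *locally rigid* if for every projectable harmonic variation $V$ there is a one-parameter subgroup $(g_t)_{t\in\mathbb{R}}$ of $O(n+1)$ with $\exp(tV)=g_t\circ\phi$ for all $t\in\mathbb{R}$. Let $\phi:M\to S^n$ be a surjective and submersive (smooth) harmonic morphism. Then: (i) $\phi$ is infinitesimally rigid. (ii) If $n$ is odd, then $\phi$ is locally rigid. -/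

import Mathlib

open scoped Manifold ContDiff
open Bundle

noncomputable section

namespace SphereRigidity

/-- Euclidean space `ℝ^k`. -/
abbrev Eucl (k : ℕ) : Type := EuclideanSpace ℝ (Fin k)

/-- The unit sphere `S^n` in `ℝ^{n+1}`, with its standard smooth structure. -/
abbrev Sph (n : ℕ) : Type := Metric.sphere (0 : Eucl (n + 1)) 1

/-- Smooth Riemannian metrics on an `m`-dimensional smooth manifold (without boundary). -/
abbrev SmoothMetric (m : ℕ) (M : Type*) [TopologicalSpace M] [ChartedSpace (Eucl m) M]
    [IsManifold (𝓡 m) ∞ M] :=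
  ContMDiffRiemannianMetric (𝓡 m) ∞ (Eucl m) (fun x : M => TangentSpace (𝓡 m) x)

/-! ### The round metric on the sphere -/

section RoundMetric

theorem finrank_fact (n : ℕ) : Fact (Module.finrank ℝ (Eucl (n + 1)) = n + 1) := ⟨by simp⟩

/-- The differential at `p` of the inclusion `S^n → ℝ^{n+1}`. -/
def inclDeriv (n : ℕ) (p : Sph n) : TangentSpace (𝓡 n) p →L[ℝ] Eucl (n + 1) :=
  mvfderiv (𝓡 n) (Subtype.val : Sph n → Eucl (n + 1)) p

/-- The inner product on `T_p S^n` induced by the inclusion in `ℝ^{n+1}`. -/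
def roundForm (n : ℕ) (p : Sph n) :
    TangentSpace (𝓡 n) p →L[ℝ] TangentSpace (𝓡 n) p →L[ℝ] ℝ :=
  let A : Eucl n →L[ℝ] Eucl (n + 1) := inclDeriv n p
  ((innerSL ℝ (E := Eucl (n + 1))).bilinearComp A A : Eucl n →L[ℝ] Eucl n →L[ℝ] ℝ)

theorem roundForm_apply (n : ℕ) (p : Sph n) (u v : TangentSpace (𝓡 n) p) :
    roundForm n p u v = inner ℝ (inclDeriv n p u) (inclDeriv n p v) := rfl

theorem roundForm_pos (n : ℕ) (p : Sph n) (u : TangentSpace (𝓡 n) p) (hu : u ≠ 0) :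
    0 < roundForm n p u u := by
  have := finrank_fact n
  rw [roundForm_apply]
  refine real_inner_self_pos.2 fun h => hu ?_
  exact injective_mvfderiv_subtypeVal_sphere p (h.trans (map_zero _).symm)

theorem isVonNBounded_of_pos {m : ℕ} (B : Eucl m →L[ℝ] Eucl m →L[ℝ] ℝ)
    (pos : ∀ a, a ≠ 0 → 0 < B a a) : Bornology.IsVonNBounded ℝ {v | B v v < 1} := by
  rw [NormedSpace.isVonNBounded_iff]
  have hc : Continuous fun v => B v v := by fun_prop
  rcases (Metric.sphere (0 : Eucl m) 1).eq_empty_or_nonempty with h | h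
  · refine Metric.isBounded_closedBall (x := (0 : Eucl m)) (r := 0) |>.subset fun v _ => ?_
    by_contra hv
    have hv : v ≠ 0 := by rintro rfl; simp at hv
    have : (‖v‖⁻¹ • v) ∈ Metric.sphere (0 : Eucl m) 1 := by
      simp [norm_smul, hv]
    simp [h] at this
  obtain ⟨w, hw, hmin⟩ := (isCompact_sphere (0 : Eucl m) 1).exists_isMinOn h hc.continuousOn
  have hw0 : w ≠ 0 := by rintro rfl; simp at hw
  have hp := pos w hw0
  refine Metric.isBounded_closedBall (x := (0 : Eucl m)) (r := √(1 / B w w)) |>.subset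
    fun v hv => ?_
  rw [mem_closedBall_zero_iff]
  apply Real.le_sqrt_of_sq_le
  rcases eq_or_ne v 0 with rfl | h0
  · simp; positivity
  have hn : 0 < ‖v‖ := norm_pos_iff.2 h0
  have : B w w ≤ B (‖v‖⁻¹ • v) (‖v‖⁻¹ • v) := hmin (by simp [norm_smul, h0])
  simp only [map_smul, smul_apply, smul_eq_mul] at this
  have hv : B v v < 1 := hv
  rw [le_div_iff₀ hp]
  calc ‖v‖ ^ 2 * B w w ≤ ‖v‖ ^ 2 * (‖v‖⁻¹ * (‖v‖⁻¹ * B v v)) := by gcongr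
    _ = B v v := by field_simp
    _ ≤ 1 := hv.le

theorem contDiff_pullbackInner (n : ℕ) :
    ContDiff ℝ ∞ (fun A : Eucl n →L[ℝ] Eucl (n + 1) =>
      (innerSL ℝ (E := Eucl (n + 1))).bilinearComp A A) := by
  have : (fun A : Eucl n →L[ℝ] Eucl (n + 1) =>
      (innerSL ℝ (E := Eucl (n + 1))).bilinearComp A A) =
      fun A => (ContinuousLinearMap.flipₗᵢ ℝ _ _ _ (((ContinuousLinearMap.flipₗᵢ ℝ _ _ _
        ((innerSL ℝ (E := Eucl (n + 1))).comp A))).comp A)) := by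
    ext A; rfl
  rw [this]
  exact (LinearIsometryEquiv.contDiff _).comp (ContDiff.clm_comp
    ((LinearIsometryEquiv.contDiff _).comp (contDiff_const.clm_comp contDiff_id)) contDiff_id)

/-- The round metric of `S^n`, induced by the inclusion in `ℝ^{n+1}`. -/
def roundMetric (n : ℕ) : SmoothMetric n (Sph n) where
  inner := roundForm n
  symm p u v := by rw [roundForm_apply, roundForm_apply, real_inner_comm]
  pos p u hu := roundForm_pos n p u hu
  isVonNBounded p := isVonNBounded_of_pos (roundForm n p) (roundForm_pos n p)
  contMDiff := by
    have := finrank_fact n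
    intro p
    rw [contMDiffAt_section]
    have h1 := (contMDiff_coe_sphere (E := Eucl (n + 1)) (n := n) (m := ∞) p).mfderiv_const
      (m := ∞) (by simp)
    have h2 := (contDiff_pullbackInner n).contMDiff.contMDiffAt.comp p h1
    refine h2.congr_of_eventuallyEq ?_
    have hp : p ∈ (trivializationAt (Eucl n) (TangentSpace (𝓡 n)) p).baseSet :=
      FiberBundle.mem_baseSet_trivializationAt' p
    filter_upwards [(trivializationAt (Eucl n) (TangentSpace (𝓡 n)) p).open_baseSet.mem_nhds hp]
      with q hq
    ext u v
    rw [hom_trivializationAt_apply]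
    have := inCoordinates_apply_eq₂ (F₃ := ℝ) (E₃ := Bundle.Trivial (Sph n) ℝ)
      (ϕ := roundForm n q) (v := u) (w := v) hq hq (Set.mem_univ q)
    refine this.trans ?_
    simp [inTangentCoordinates, ContinuousLinearMap.inCoordinates]
    rw [← Trivialization.symmL_apply (R := ℝ) _ hq, ← Trivialization.symmL_apply (R := ℝ) _ hq]
    rfl

end RoundMetric

/-! ### Riemannian geometry of the domain, in the preferred chart at a point

`TangentSpace (𝓡 m) x` is by definition the model space `ℝ^m`, a vector being identified with its
coordinates in the preferred chart at `x`.  All derivatives below are taken in that chart; constant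
vectors `u : ℝ^m` stand for the corresponding coordinate vector fields near `x`. -/

section Domain

theorem exists_orthonormal_aux {m : ℕ} {F : Type*} [AddCommGroup F] [Module ℝ F]
    [FiniteDimensional ℝ F] (hd : Module.finrank ℝ F = m) (B : F → F → ℝ)
    (hl : ∀ a b c, B (a + b) c = B a c + B b c) (hs : ∀ (r : ℝ) a b, B (r • a) b = r * B a b)
    (symm : ∀ a b, B a b = B b a) (pos : ∀ a, a ≠ 0 → 0 < B a a) :
    ∃ e : Fin m → F, ∀ i j, B (e i) (e j) = if i = j then 1 else 0 := by
  have h0 : ∀ b, B 0 b = 0 := fun b => by simpa using hs 0 0 b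
  let c : InnerProductSpace.Core ℝ F :=
    { inner := B
      conj_inner_symm := fun a b => by simpa using symm b a
      re_inner_nonneg := fun a => by
        rcases eq_or_ne a 0 with rfl | h
        · simp [h0]
        · simpa using (pos a h).le
      add_left := hl
      smul_left := fun a b r => by simpa using hs r a b
      definite := fun a h => by
        by_contra hne
        exact (pos a hne).ne' h }
  let _ : NormedAddCommGroup F := c.toNormedAddCommGroup
  let _ : InnerProductSpace ℝ F := InnerProductSpace.ofCore c.toCore
  let b := (stdOrthonormalBasis ℝ F).reindex (finCongr hd)
  exact ⟨b, fun i j => orthonormal_iff_ite.1 b.orthonormal i j⟩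

variable {m : ℕ} {M : Type*} [TopologicalSpace M] [ChartedSpace (Eucl m) M]
  [IsManifold (𝓡 m) ∞ M]

/-- A map on `M` read in the preferred chart at `x`. -/
def inChart {W : Type*} (x : M) (F : M → W) : Eucl m → W :=
  fun y => F ((extChartAt (𝓡 m) x).symm y)

/-- The coordinates of `x` in its preferred chart. -/
def center (x : M) : Eucl m := extChartAt (𝓡 m) x x

/-- The coordinate vector field with constant coordinates `u` in the chart at `x`, at the point
with coordinates `y`. -/
def coordField (x : M) (u y : Eucl m) : TangentSpace (𝓡 m) ((extChartAt (𝓡 m) x).symm y) :=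
  mfderiv 𝓘(ℝ, Eucl m) (𝓡 m) (extChartAt (𝓡 m) x).symm y u

/-- The metric coefficient `g(∂_u, ∂_v)` as a function of the coordinates. -/
def metricCoeff (g : SmoothMetric m M) (x : M) (u v y : Eucl m) : ℝ :=
  g.inner ((extChartAt (𝓡 m) x).symm y) (coordField x u y) (coordField x v y)

/-- The Christoffel symbol of the first kind at `x`,
`½ (∂_u g(∂_v, ∂_w) + ∂_v g(∂_u, ∂_w) - ∂_w g(∂_u, ∂_v))`. -/
def christoffelLower (g : SmoothMetric m M) (x : M) (u v w : Eucl m) : ℝ :=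
  (1 / 2) * (fderiv ℝ (metricCoeff g x v w) (center x) u
    + fderiv ℝ (metricCoeff g x u w) (center x) v
    - fderiv ℝ (metricCoeff g x u v) (center x) w)

theorem exists_orthonormalFrame (g : SmoothMetric m M) (x : M) :
    ∃ e : Fin m → Eucl m, ∀ i j, g.inner x (e i) (e j) = if i = j then 1 else 0 := by
  let B : Eucl m → Eucl m → ℝ := fun u v => g.inner x u v
  have hl : ∀ a b c, B (a + b) c = B a c + B b c := fun a b c =>
    congrArg (fun L : TangentSpace (𝓡 m) x →L[ℝ] ℝ => L c) (map_add (g.inner x) a b)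
  have hs : ∀ (r : ℝ) a b, B (r • a) b = r * B a b := fun r a b =>
    congrArg (fun L : TangentSpace (𝓡 m) x →L[ℝ] ℝ => L b) (map_smul (g.inner x) r a)
  have hsymm : ∀ a b, B a b = B b a := fun a b => g.symm x a b
  have hpos : ∀ a, a ≠ 0 → 0 < B a a := fun a ha => g.pos x a ha
  exact exists_orthonormal_aux (finrank_euclideanSpace_fin (𝕜 := ℝ)) B hl hs hsymm hpos

/-- A `g`-orthonormal basis `(e_i)` of `T_x M`. -/
def frame (g : SmoothMetric m M) (x : M) : Fin m → Eucl m :=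
  (exists_orthonormalFrame g x).choose

/-- The Levi-Civita derivative `∇_u ∂_v` at `x` of coordinate fields: the vector `Γ(u, v)` with
`g(Γ(u, v), w) = christoffelLower g x u v w` for all `w`. -/
def christoffel (g : SmoothMetric m M) (x : M) (u v : Eucl m) : Eucl m :=
  ∑ i, christoffelLower g x u v (frame g x i) • frame g x i

/-- The Laplacian `trace ∇df` of a function at `x`. -/
def laplacian (g : SmoothMetric m M) (f : M → ℝ) (x : M) : ℝ :=
  ∑ i, (fderiv ℝ (fun y => fderiv ℝ (inChart x f) y (frame g x i)) (center x) (frame g x i)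
    - fderiv ℝ (inChart x f) (center x) (christoffel g x (frame g x i) (frame g x i)))

/-- `f` is a (smooth) harmonic function on the open set `U`. -/
def IsHarmonicFunctionOn (g : SmoothMetric m M) (f : M → ℝ) (U : Set M) : Prop :=
  ContMDiffOn (𝓡 m) 𝓘(ℝ, ℝ) ∞ f U ∧ ∀ x ∈ U, laplacian g f x = 0

end Domain

/-- A smooth map between Riemannian manifolds is a harmonic morphism if it pulls back harmonic
functions on open subsets to harmonic functions. -/
def IsHarmonicMorphism {m n : ℕ} {M N : Type*}
    [TopologicalSpace M] [ChartedSpace (Eucl m) M] [IsManifold (𝓡 m) ∞ M]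
    [TopologicalSpace N] [ChartedSpace (Eucl n) N] [IsManifold (𝓡 n) ∞ N]
    (g : SmoothMetric m M) (h : SmoothMetric n N) (φ : M → N) : Prop :=
  ContMDiff (𝓡 m) (𝓡 n) ∞ φ ∧
    ∀ (U : Set N) (f : N → ℝ), IsOpen U → IsHarmonicFunctionOn h f U →
      IsHarmonicFunctionOn g (f ∘ φ) (φ ⁻¹' U)

/-! ### Geometry of the sphere as a submanifold of Euclidean space

The tangent space `T_p S^n` is the orthogonal complement of `p` in `ℝ^{n+1}`, and the Levi-Civita
connection of the round metric is the tangential part of the Euclidean derivative. -/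

section Target

variable {n : ℕ}

/-- The orthogonal projection of `ℝ^{n+1}` onto `T_p S^n`, for `p` a unit vector. -/
def tangentPart (p w : Eucl (n + 1)) : Eucl (n + 1) := w - (inner ℝ p w : ℝ) • p

/-- The Levi-Civita derivative `∇_X Y` on `S^n`, for vector fields tangent to `S^n` that are
given as fields on `ℝ^{n+1}`. -/
def sphereNabla (X Y : Eucl (n + 1) → Eucl (n + 1)) : Eucl (n + 1) → Eucl (n + 1) :=
  fun q => tangentPart q (fderiv ℝ Y q (X q))

/-- An extension of a tangent vector to a field that is tangent to `S^n`. -/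
def tangentExtension (w : Eucl (n + 1)) : Eucl (n + 1) → Eucl (n + 1) :=
  fun q => tangentPart q w

/-- The curvature tensor of `S^n` at `p` on tangent vectors, in Milnor's sign convention
`R(X, Y) Z = ∇_{[X, Y]} Z - ∇_X ∇_Y Z + ∇_Y ∇_X Z`. -/
def sphereCurvature (p : Sph n) (a b c : Eucl (n + 1)) : Eucl (n + 1) :=
  let X := tangentExtension a
  let Y := tangentExtension b
  let Z := tangentExtension c
  sphereNabla (VectorField.lieBracket ℝ X Y) Z p - sphereNabla X (sphereNabla Y Z) p
    + sphereNabla Y (sphereNabla X Z) p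

/-- `γ` is a geodesic of `S^n` defined on all of `ℝ`: the tangential part of its acceleration
vanishes. -/
def IsGeodesic (γ : ℝ → Sph n) : Prop :=
  ContDiff ℝ ∞ (fun t => (γ t : Eucl (n + 1))) ∧
    ∀ t, tangentPart (γ t : Eucl (n + 1))
      (deriv (deriv (fun s => (γ s : Eucl (n + 1)))) t) = 0

open Classical in
/-- The exponential map of `S^n`: `exp_p v = γ(1)` for the geodesic `γ` with `γ(0) = p` and
`γ'(0) = v` (and, by convention, `p` if `v` is not tangent at `p`). -/
def sphereExp (p : Sph n) (v : Eucl (n + 1)) : Sph n :=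
  if h : ∃ γ : ℝ → Sph n, IsGeodesic γ ∧ γ 0 = p ∧
      deriv (fun t => (γ t : Eucl (n + 1))) 0 = v
  then h.choose 1 else p

end Target

/-! ### Maps into the sphere and vector fields along them -/

section Maps

variable {m n : ℕ} {M : Type*} [TopologicalSpace M] [ChartedSpace (Eucl m) M]
  [IsManifold (𝓡 m) ∞ M]

/-- `dφ(∂_v)` in the chart at `x`, at the point with coordinates `y`. -/
def mapDeriv (φ : M → Sph n) (x : M) (v y : Eucl m) : Eucl (n + 1) :=
  fderiv ℝ (inChart x fun z => (φ z : Eucl (n + 1))) y v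

/-- The second fundamental form `(∇dφ)(u, v) = ∇^φ_u (dφ(∂_v)) - dφ(∇_u ∂_v)` at `x`. -/
def secondForm (g : SmoothMetric m M) (φ : M → Sph n) (x : M) (u v : Eucl m) : Eucl (n + 1) :=
  tangentPart (φ x : Eucl (n + 1)) (fderiv ℝ (mapDeriv φ x v) (center x) u)
    - mapDeriv φ x (christoffel g x u v) (center x)

/-- The tension field `τ_φ = trace ∇dφ`. -/
def tension (g : SmoothMetric m M) (φ : M → Sph n) (x : M) : Eucl (n + 1) :=
  ∑ i, secondForm g φ x (frame g x i) (frame g x i)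

/-- A harmonic map is a smooth map with vanishing tension field. -/
def IsHarmonicMap (g : SmoothMetric m M) (φ : M → Sph n) : Prop :=
  ContMDiff (𝓡 m) (𝓡 n) ∞ φ ∧ ∀ x, tension g φ x = 0

/-- `V` is a (smooth) vector field along `φ`, that is, a section of `φ⁻¹ T S^n`. -/
def IsVectorFieldAlong (m : ℕ) {n : ℕ} {M : Type*} [TopologicalSpace M]
    [ChartedSpace (Eucl m) M] (φ : M → Sph n) (V : M → Eucl (n + 1)) : Prop :=
  ContMDiff (𝓡 m) 𝓘(ℝ, Eucl (n + 1)) ∞ V ∧ ∀ x, inner ℝ (φ x : Eucl (n + 1)) (V x) = 0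

/-- The pull-back connection: `∇^φ_{∂_v} V` in the chart at `x`, at the point with
coordinates `y`. -/
def pullbackNabla (φ : M → Sph n) (V : M → Eucl (n + 1)) (x : M) (v y : Eucl m) :
    Eucl (n + 1) :=
  tangentPart (inChart x (fun z => (φ z : Eucl (n + 1))) y) (fderiv ℝ (inChart x V) y v)

/-- The second covariant derivative
`∇²_{u, v} V = ∇^φ_u (∇^φ_{∂_v} V) - ∇^φ_{∇_u ∂_v} V` at `x`. -/
def secondNabla (g : SmoothMetric m M) (φ : M → Sph n) (V : M → Eucl (n + 1)) (x : M)
    (u v : Eucl m) : Eucl (n + 1) :=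
  tangentPart (φ x : Eucl (n + 1)) (fderiv ℝ (pullbackNabla φ V x v) (center x) u)
    - pullbackNabla φ V x (christoffel g x u v) (center x)

/-- The Jacobi operator `J^φ V = - trace ∇² V - trace R(dφ, V) dφ`. -/
def jacobi (g : SmoothMetric m M) (φ : M → Sph n) (V : M → Eucl (n + 1)) (x : M) :
    Eucl (n + 1) :=
  - ∑ i, secondNabla g φ V x (frame g x i) (frame g x i)
    - ∑ i, sphereCurvature (φ x) (mapDeriv φ x (frame g x i) (center x)) (V x)
        (mapDeriv φ x (frame g x i) (center x))

/-- `V` is a Jacobi field along `φ`. -/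
def IsJacobiField (g : SmoothMetric m M) (φ : M → Sph n) (V : M → Eucl (n + 1)) : Prop :=
  IsVectorFieldAlong m φ V ∧ ∀ x, jacobi g φ V x = 0

/-- `V ∈ K(φ)`: `V` is a Jacobi field along `φ` with `trace ⟨dφ, ∇^φ V⟩ = 0`. -/
def MemK (g : SmoothMetric m M) (φ : M → Sph n) (V : M → Eucl (n + 1)) : Prop :=
  IsJacobiField g φ V ∧
    ∀ x, ∑ i, inner ℝ (mapDeriv φ x (frame g x i) (center x))
      (pullbackNabla φ V x (frame g x i) (center x)) = 0

/-- The deformation `φ_t = exp(tV)` of `φ`. -/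
def expVariation (φ : M → Sph n) (V : M → Eucl (n + 1)) (t : ℝ) : M → Sph n :=
  fun x => sphereExp (φ x) (t • V x)

/-- `V` is a harmonic variation of `φ`: `exp(tV)` is a harmonic map for all real `t`. -/
def IsHarmonicVariation (g : SmoothMetric m M) (φ : M → Sph n) (V : M → Eucl (n + 1)) : Prop :=
  IsVectorFieldAlong m φ V ∧ ∀ t : ℝ, IsHarmonicMap g (expVariation φ V t)

/-- `V` is projectable: it is constant on the fibres of `φ`. -/
def IsProjectable (φ : M → Sph n) (V : M → Eucl (n + 1)) : Prop :=
  ∀ x x', φ x = φ x' → V x = V x'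

/-- `φ` is an infinitesimally rigid harmonic map: every projectable `V ∈ K(φ)` is `X ∘ φ` for
some `X ∈ so(n+1)`, acting on `S^n` as the vector field `p ↦ X p`. -/
def IsInfinitesimallyRigid (g : SmoothMetric m M) (φ : M → Sph n) : Prop :=
  IsHarmonicMap g φ ∧
    ∀ V : M → Eucl (n + 1), IsProjectable φ V → MemK g φ V →
      ∃ X ∈ LieAlgebra.Orthogonal.so (Fin (n + 1)) ℝ,
        ∀ x, V x = Matrix.toEuclideanLin X (φ x : Eucl (n + 1))

/-- `φ` is a locally rigid harmonic map: for every projectable harmonic variation `V` there is a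
one-parameter subgroup `(g_t)` of `O(n+1)` with `exp(tV) = g_t ∘ φ` for all real `t`. -/
def IsLocallyRigid (g : SmoothMetric m M) (φ : M → Sph n) : Prop :=
  IsHarmonicMap g φ ∧
    ∀ V : M → Eucl (n + 1), IsProjectable φ V → IsHarmonicVariation g φ V →
      ∃ G : Multiplicative ℝ →ₜ* Matrix.orthogonalGroup (Fin (n + 1)) ℝ,
        ∀ (t : ℝ) (x : M), (expVariation φ V t x : Eucl (n + 1)) =
          Matrix.toEuclideanLin
            (G (Multiplicative.ofAdd t) : Matrix (Fin (n + 1)) (Fin (n + 1)) ℝ)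
            (φ x : Eucl (n + 1))

end Maps

end SphereRigidity

end

open SphereRigidity

/-! Testing `φ` against the functions `∫ z⁻ⁿ` of isotropic complex linear forms
`z = ⟨u, ·⟩ + i ⟨v, ·⟩`, which are harmonic where `z` lies in the slit plane, shows that `φ` is
harmonic and horizontally conformal, with square dilation `e(φ) / n` for the energy density
`e(φ) = |dφ|²`. Consequently, if `V = W ∘ φ` with `W` homogeneous on `ℝⁿ⁺¹ ∖ 0`, then `ΔV` is a
positive multiple of the value of `ΔW` at `φ`, up to a multiple of `V`. Here `W` is smooth because
`φ` is a surjective submersion.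

For `V` in `K(φ)` the two defining equations give `ΔV = -e(φ) V`. Hence the extension of `V` to a
homogeneous map of degree one is harmonic; its first derivatives are harmonic and homogeneous of
degree zero, so they are constant, and `V = X ∘ φ` with `X` linear. It is skew-symmetric because
`V` is orthogonal to `φ`.

Let `V` be a projectable harmonic variation. Near a point `x` with `V x ≠ 0`, harmonicity of
`exp(tV)` at the time `t = π / ‖V x‖` at which `x` is sent to `-φ x` gives `Δ‖V‖ = 0` at `x`. So
`‖V‖²` is subharmonic, and so is its homogeneous extension of degree zero, which is therefore
constant: integrate its Laplacian against radial bump functions. With `c = ‖V‖`, the times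
`π / 2c` and `π / 4c` give `ΔV = -e(φ) V` again, so that `V = X ∘ φ` with `X² = -c²`, and
`exp(tV) = cos(ct) φ + sin(ct) V / c` is the action of `exp(tX)` on `φ`. -/

noncomputable section

namespace SphereRigidity

/-! ### Second-order operators -/

section SecondOrder

open Filter Topology

variable {E F G H : Type*} [NormedAddCommGroup E] [NormedSpace ℝ E]
  [NormedAddCommGroup F] [NormedSpace ℝ F] [NormedAddCommGroup G] [NormedSpace ℝ G]
  [NormedAddCommGroup H] [NormedSpace ℝ H] {ι : Type*} [Fintype ι]

theorem eventually_differentiableAt {f : E → F} {x : E} (hf : ContDiffAt ℝ 2 f x) :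
    ∀ᶠ y in 𝓝 x, DifferentiableAt ℝ f y :=
  (hf.eventually (by simp)).mono fun _ h => h.differentiableAt two_ne_zero

theorem differentiableAt_fderiv {f : E → F} {x : E} (hf : ContDiffAt ℝ 2 f x) :
    DifferentiableAt ℝ (fderiv ℝ f) x :=
  (hf.fderiv_right (m := 1) (by norm_num)).differentiableAt one_ne_zero

theorem continuousAt_fderiv_fderiv_apply {f : E → F}
    {x : E} (hf : ContDiffAt ℝ 2 f x) (u v : E) :
    ContinuousAt (fun y => fderiv ℝ (fderiv ℝ f) y u v) x :=
  (((hf.fderiv_right (m := 1) (by norm_num)).continuousAt_fderiv one_ne_zero).clm_apply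
    continuousAt_const).clm_apply continuousAt_const

theorem fderiv_fderiv_apply {f : E → F} {x : E} (hf : ContDiffAt ℝ 2 f x) (u v : E) :
    fderiv ℝ (fun y => fderiv ℝ f y v) x u = fderiv ℝ (fderiv ℝ f) x u v := by
  rw [fderiv_clm_apply (differentiableAt_fderiv hf) (differentiableAt_const v)]
  simp

theorem fderiv_fderiv_bilinear (B : F →L[ℝ] G →L[ℝ] H) {f : E → F} {g : E → G} {x : E}
    (hf : ContDiffAt ℝ 2 f x) (hg : ContDiffAt ℝ 2 g x) (u v : E) :
    fderiv ℝ (fderiv ℝ fun y => B (f y) (g y)) x u v =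
      B (fderiv ℝ (fderiv ℝ f) x u v) (g x) + B (fderiv ℝ f x v) (fderiv ℝ g x u)
        + B (fderiv ℝ f x u) (fderiv ℝ g x v) + B (f x) (fderiv ℝ (fderiv ℝ g) x u v) := by
  have hB : (fderiv ℝ fun y => B (f y) (g y)) =ᶠ[𝓝 x]
      fun y => B.precompR E (f y) (fderiv ℝ g y) + B.precompL E (fderiv ℝ f y) (g y) := by
    filter_upwards [eventually_differentiableAt hf, eventually_differentiableAt hg] with y h h'
    exact B.fderiv_of_bilinear h h'
  have df := (hf.differentiableAt two_ne_zero).hasFDerivAt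
  have dg := (hg.differentiableAt two_ne_zero).hasFDerivAt
  have d := ((B.precompR E).hasFDerivAt_of_bilinear df
    (differentiableAt_fderiv hg).hasFDerivAt).fun_add
      ((B.precompL E).hasFDerivAt_of_bilinear (differentiableAt_fderiv hf).hasFDerivAt dg)
  rw [hB.fderiv_eq, d.fderiv]
  simp
  abel

theorem fderiv_fderiv_comp {h : F → G} {f : E → F} {x : E}
    (hh : ContDiffAt ℝ 2 h (f x)) (hf : ContDiffAt ℝ 2 f x) (u v : E) :
    fderiv ℝ (fderiv ℝ (h ∘ f)) x u v =
      fderiv ℝ (fderiv ℝ h) (f x) (fderiv ℝ f x u) (fderiv ℝ f x v)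
        + fderiv ℝ h (f x) (fderiv ℝ (fderiv ℝ f) x u v) := by
  have hc : fderiv ℝ (h ∘ f) =ᶠ[𝓝 x] fun y => (fderiv ℝ h (f y)).comp (fderiv ℝ f y) := by
    filter_upwards [eventually_differentiableAt hf,
      hf.continuousAt.eventually (eventually_differentiableAt hh)] with y hy hy'
    exact fderiv_comp y hy' hy
  have df := (hf.differentiableAt two_ne_zero).hasFDerivAt
  have d := ((differentiableAt_fderiv hh).hasFDerivAt.comp x df).clm_comp
    (differentiableAt_fderiv hf).hasFDerivAt
  rw [hc.fderiv_eq]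
  refine (congrArg (fun A : E →L[ℝ] E →L[ℝ] G => A u v) d.fderiv).trans ?_
  simp [add_comm]

theorem fderiv_fderiv_comp_of_hasDerivAt {𝕜 : Type*} [NontriviallyNormedField 𝕜]
    [NormedAlgebra ℝ 𝕜] {h h' : 𝕜 → 𝕜} {h'' : 𝕜} {f : E → 𝕜} {x : E}
    (hh : ∀ᶠ z in 𝓝 (f x), HasDerivAt h (h' z) z) (hh' : HasDerivAt h' h'' (f x))
    (hf : ContDiffAt ℝ 2 f x) (u v : E) :
    fderiv ℝ (fderiv ℝ (h ∘ f)) x u v =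
      h'' * (fderiv ℝ f x u * fderiv ℝ f x v) + h' (f x) * fderiv ℝ (fderiv ℝ f) x u v := by
  have hc : fderiv ℝ (h ∘ f) =ᶠ[𝓝 x] fun y => h' (f y) • fderiv ℝ f y := by
    filter_upwards [eventually_differentiableAt hf, hf.continuousAt.eventually hh] with y hy hy'
    exact (hy'.comp_hasFDerivAt y hy.hasFDerivAt).fderiv
  have df := (hf.differentiableAt two_ne_zero).hasFDerivAt
  have d := (hh'.comp_hasFDerivAt x df).smul (differentiableAt_fderiv hf).hasFDerivAt
  rw [hc.fderiv_eq]
  refine (congrArg (fun A : E →L[ℝ] E →L[ℝ] 𝕜 => A u v) d.fderiv).trans ?_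
  simp
  ring

/-- The second-order operator `∑ i, ∂_{e i}² - ∂_c` without zeroth-order term; both the Laplacian
of a Euclidean space and, in a chart, that of a Riemannian manifold have this form. -/
def secondOrderOp (e : ι → E) (c : E) (f : E → F) (x : E) : F :=
  ∑ i, fderiv ℝ (fderiv ℝ f) x (e i) (e i) - fderiv ℝ f x c

theorem secondOrderOp_bilinear (B : F →L[ℝ] G →L[ℝ] H) {f : E → F} {g : E → G} {x : E}
    (hf : ContDiffAt ℝ 2 f x) (hg : ContDiffAt ℝ 2 g x) (e : ι → E) (c : E) :
    secondOrderOp e c (fun y => B (f y) (g y)) x =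
      B (secondOrderOp e c f x) (g x)
        + (2 : ℝ) • ∑ i, B (fderiv ℝ f x (e i)) (fderiv ℝ g x (e i))
        + B (f x) (secondOrderOp e c g x) := by
  have h := B.fderiv_of_bilinear (hf.differentiableAt two_ne_zero)
    (hg.differentiableAt two_ne_zero)
  simp only [secondOrderOp, fderiv_fderiv_bilinear B hf hg, Finset.sum_add_distrib, h, map_sub,
    map_sum, add_apply, ContinuousLinearMap.precompR_apply, ContinuousLinearMap.compL_apply,
    ContinuousLinearMap.comp_apply, ContinuousLinearMap.precompL_apply, sub_apply,
    sum_apply, two_smul]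
  abel

theorem secondOrderOp_smul {f : E → ℝ} {g : E → F} {x : E} (hf : ContDiffAt ℝ 2 f x)
    (hg : ContDiffAt ℝ 2 g x) (e : ι → E) (c : E) :
    secondOrderOp e c (fun y => f y • g y) x = secondOrderOp e c f x • g x
      + (2 : ℝ) • ∑ i, fderiv ℝ f x (e i) • fderiv ℝ g x (e i)
      + f x • secondOrderOp e c g x :=
  secondOrderOp_bilinear (ContinuousLinearMap.lsmul ℝ ℝ) hf hg e c

theorem secondOrderOp_inner {V : Type*} [NormedAddCommGroup V] [InnerProductSpace ℝ V]
    {f g : E → V} {x : E} (hf : ContDiffAt ℝ 2 f x) (hg : ContDiffAt ℝ 2 g x) (e : ι → E) (c : E) :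
    secondOrderOp e c (fun y => inner ℝ (f y) (g y)) x = inner ℝ (secondOrderOp e c f x) (g x)
      + 2 * ∑ i, inner ℝ (fderiv ℝ f x (e i)) (fderiv ℝ g x (e i))
      + inner ℝ (f x) (secondOrderOp e c g x) :=
  secondOrderOp_bilinear (innerSL ℝ (E := V)) hf hg e c

theorem secondOrderOp_comp {h : F → G} {f : E → F} {x : E}
    (hh : ContDiffAt ℝ 2 h (f x)) (hf : ContDiffAt ℝ 2 f x) (e : ι → E) (c : E) :
    secondOrderOp e c (h ∘ f) x =
      ∑ i, fderiv ℝ (fderiv ℝ h) (f x) (fderiv ℝ f x (e i)) (fderiv ℝ f x (e i))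
        + fderiv ℝ h (f x) (secondOrderOp e c f x) := by
  simp only [secondOrderOp, fderiv_fderiv_comp hh hf, Finset.sum_add_distrib, map_sub, map_sum,
    fderiv_comp x (hh.differentiableAt two_ne_zero) (hf.differentiableAt two_ne_zero),
    ContinuousLinearMap.comp_apply, add_sub_assoc]

theorem secondOrderOp_comp_of_hasDerivAt {𝕜 : Type*} [NontriviallyNormedField 𝕜]
    [NormedAlgebra ℝ 𝕜] {h h' : 𝕜 → 𝕜} {h'' : 𝕜} {f : E → 𝕜} {x : E}
    (hh : ∀ᶠ z in 𝓝 (f x), HasDerivAt h (h' z) z) (hh' : HasDerivAt h' h'' (f x))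
    (hf : ContDiffAt ℝ 2 f x) (e : ι → E) (c : E) :
    secondOrderOp e c (h ∘ f) x =
      h'' * ∑ i, fderiv ℝ f x (e i) ^ 2 + h' (f x) * secondOrderOp e c f x := by
  have d := hh.self_of_nhds.comp_hasFDerivAt x (hf.differentiableAt two_ne_zero).hasFDerivAt
  simp only [secondOrderOp, fderiv_fderiv_comp_of_hasDerivAt hh hh' hf, d.fderiv,
    Finset.sum_add_distrib, ← Finset.mul_sum, smul_apply, smul_eq_mul, mul_sub, add_sub_assoc,
    pow_two]

theorem secondOrderOp_clm_comp (A : F →L[ℝ] G) {f : E → F} {x : E} (hf : ContDiffAt ℝ 2 f x)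
    (e : ι → E) (c : E) : secondOrderOp e c (fun y => A (f y)) x = A (secondOrderOp e c f x) := by
  have hA : fderiv ℝ (A : F → G) = fun _ => A := funext fun _ => A.fderiv
  exact (secondOrderOp_comp A.contDiff.contDiffAt hf e c).trans (by simp [hA])

theorem secondOrderOp_add {f g : E → F} {x : E} (hf : ContDiffAt ℝ 2 f x)
    (hg : ContDiffAt ℝ 2 g x) (e : ι → E) (c : E) :
    secondOrderOp e c (fun y => f y + g y) x = secondOrderOp e c f x + secondOrderOp e c g x := by
  have hfg := hf.prodMk hg
  have h₁ := secondOrderOp_clm_comp (ContinuousLinearMap.fst ℝ F F) hfg e c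
  have h₂ := secondOrderOp_clm_comp (ContinuousLinearMap.snd ℝ F F) hfg e c
  have h := secondOrderOp_clm_comp
    (ContinuousLinearMap.fst ℝ F F + ContinuousLinearMap.snd ℝ F F) hfg e c
  simp only [add_apply, ContinuousLinearMap.coe_fst', ContinuousLinearMap.coe_snd'] at h h₁ h₂
  rw [h, h₁, h₂]

theorem secondOrderOp_const (a : F) (e : ι → E) (c x : E) :
    secondOrderOp e c (fun _ => a) x = 0 := by
  simp [secondOrderOp, fderiv_fun_const]

end SecondOrder

/-! ### Homogeneous harmonic functions -/

section Homogeneous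

open Filter Topology MeasureTheory Laplacian

section Normed

variable {E F : Type*} [NormedAddCommGroup E] [NormedSpace ℝ E]
  [NormedAddCommGroup F] [NormedSpace ℝ F]

/-- Positive homogeneity of degree `k` on the punctured space; the value at `0` is irrelevant. -/
def IsHomogeneous (k : ℤ) (f : E → F) : Prop :=
  ∀ x : E, x ≠ 0 → ∀ r : ℝ, 0 < r → f (r • x) = r ^ k • f x

/-- Smoothness on the punctured space. -/
def IsSmoothOffZero (f : E → F) : Prop := ∀ x : E, x ≠ 0 → ContDiffAt ℝ ∞ f x

theorem IsSmoothOffZero.contDiffAt_two {f : E → F} (hf : IsSmoothOffZero f) {x : E}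
    (hx : x ≠ 0) : ContDiffAt ℝ 2 f x :=
  (hf x hx).of_le (WithTop.coe_le_coe.2 le_top)

theorem IsSmoothOffZero.differentiableAt {f : E → F} (hf : IsSmoothOffZero f) {x : E}
    (hx : x ≠ 0) : DifferentiableAt ℝ f x :=
  (hf x hx).differentiableAt (by simp)

theorem IsSmoothOffZero.fderiv_apply {f : E → F} (hf : IsSmoothOffZero f) (v : E) :
    IsSmoothOffZero fun y => fderiv ℝ f y v := fun x hx =>
  ((hf x hx).fderiv_right (m := ∞) (by simp)).clm_apply contDiffAt_const

theorem IsHomogeneous.fderiv_apply_self {k : ℤ} {f : E → F} (hk : IsHomogeneous k f) {x : E}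
    (hx : x ≠ 0) (hf : DifferentiableAt ℝ f x) : fderiv ℝ f x x = (k : ℝ) • f x := by
  have hray : HasDerivAt (fun r : ℝ => r • x) x 1 := by
    simpa using (hasDerivAt_id (1 : ℝ)).smul_const x
  have hcomp : HasDerivAt (fun r : ℝ => f (r • x)) (fderiv ℝ f x x) 1 :=
    HasFDerivAt.comp_hasDerivAt (f := fun r : ℝ => r • x) 1
      (by simpa using hf.hasFDerivAt) hray
  have hpow : HasDerivAt (fun r : ℝ => r ^ k • f x) ((k : ℝ) • f x) 1 := by
    simpa using (hasDerivAt_zpow k (1 : ℝ) (by simp)).smul_const (f x)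
  refine hcomp.unique (hpow.congr_of_eventuallyEq ?_)
  filter_upwards [lt_mem_nhds (zero_lt_one (α := ℝ))] with r hr using hk x hx r hr

theorem IsHomogeneous.fderiv_apply {k : ℤ} {f : E → F} (hk : IsHomogeneous k f) (v : E) :
    IsHomogeneous (k - 1) fun y => fderiv ℝ f y v := by
  intro x hx r hr
  have hscale : (fun y => f (r • y)) =ᶠ[𝓝 x] fun y => r ^ k • f y := by
    filter_upwards [isOpen_ne.mem_nhds hx] with y hy using hk y hy r hr
  have hd : r • fderiv ℝ f (r • x) = r ^ k • fderiv ℝ f x :=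
    calc r • fderiv ℝ f (r • x) = fderiv ℝ (fun y => f (r • y)) x :=
          (fderiv_comp_smul (𝕜 := ℝ) (f := f) (c := r) (x := x)).symm
      _ = fderiv ℝ (fun y => r ^ k • f y) x := hscale.fderiv_eq
      _ = r ^ k • fderiv ℝ f x := congrFun (fderiv_const_smul_field (r ^ k)) x
  calc fderiv ℝ f (r • x) v = r⁻¹ • (r • fderiv ℝ f (r • x)) v := by
        rw [smul_apply, inv_smul_smul₀ hr.ne']
    _ = r ^ (k - 1) • fderiv ℝ f x v := by
        rw [hd, smul_apply, smul_smul, zpow_sub_one₀ hr.ne', mul_comm]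

theorem IsHomogeneous.fderiv_fderiv_apply_self {k : ℤ} {f : E → F} (hk : IsHomogeneous k f)
    (hf : IsSmoothOffZero f) {x : E} (hx : x ≠ 0) (v : E) :
    fderiv ℝ (fderiv ℝ f) x x v = ((k : ℝ) - 1) • fderiv ℝ f x v := by
  rw [← fderiv_fderiv_apply (hf.contDiffAt_two hx),
    (hk.fderiv_apply v).fderiv_apply_self hx ((hf.fderiv_apply v).differentiableAt hx)]
  norm_num

end Normed

variable {E F : Type*} [NormedAddCommGroup E] [InnerProductSpace ℝ E] [FiniteDimensional ℝ E]

theorem laplacian_eq_secondOrderOp [NormedAddCommGroup F] [NormedSpace ℝ F] {ι : Type*}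
    [Fintype ι] (b : OrthonormalBasis ι ℝ E) (f : E → F) : Δ f = secondOrderOp b 0 f := by
  ext x
  simp [InnerProductSpace.laplacian_eq_iteratedFDeriv_orthonormalBasis f b, secondOrderOp,
    iteratedFDeriv_two_apply]

theorem laplacian_eq_sum [NormedAddCommGroup F] [NormedSpace ℝ F] {ι : Type*}
    [Fintype ι] (b : OrthonormalBasis ι ℝ E) (f : E → F) (x : E) :
    Δ f x = ∑ i, fderiv ℝ (fderiv ℝ f) x (b i) (b i) := by
  simp [laplacian_eq_secondOrderOp b, secondOrderOp]

theorem IsHomogeneous.laplacian [NormedAddCommGroup F] [NormedSpace ℝ F] {f : E → F} {k : ℤ}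
    (hk : IsHomogeneous k f) (hf : IsSmoothOffZero f) : IsHomogeneous (k - 1 - 1) (Δ f) := by
  let b := stdOrthonormalBasis ℝ E
  intro x hx r hr
  have hrx : r • x ≠ 0 := smul_ne_zero hr.ne' hx
  simp only [laplacian_eq_sum b, Finset.smul_sum, ← fderiv_fderiv_apply (hf.contDiffAt_two hx),
    ← fderiv_fderiv_apply (hf.contDiffAt_two hrx)]
  exact Finset.sum_congr rfl fun i _ => ((hk.fderiv_apply _).fderiv_apply _) x hx r hr

theorem laplacian_norm_sq [NormedAddCommGroup F] [InnerProductSpace ℝ F] {ι : Type*} [Fintype ι]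
    (b : OrthonormalBasis ι ℝ E) {f : E → F} {x : E} (hf : ContDiffAt ℝ 2 f x) :
    Δ (fun y => ‖f y‖ ^ 2) x =
      2 * inner ℝ (f x) (Δ f x) + 2 * ∑ i, ‖fderiv ℝ f x (b i)‖ ^ 2 := by
  have h := secondOrderOp_inner hf hf b 0
  simp only [real_inner_self_eq_norm_sq] at h
  rw [laplacian_eq_secondOrderOp b, laplacian_eq_secondOrderOp b, h,
    real_inner_comm (f x)]
  ring

theorem laplacian_fderiv_apply [NormedAddCommGroup F] [NormedSpace ℝ F] {f : E → F} {x : E}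
    (hf : ContDiffAt ℝ 3 f x) (v : E) :
    Δ (fun y => fderiv ℝ f y v) x = fderiv ℝ (Δ f) x v := by
  have hf₂ : ContDiffAt ℝ 2 f x := hf.of_le (by norm_num)
  have hdir : ∀ w, ContDiffAt ℝ 2 (fun y => fderiv ℝ f y w) x := fun w =>
    (hf.fderiv_right (m := 2) (by norm_num)).clm_apply contDiffAt_const
  have hsymm : ∀ w, fderiv ℝ (fderiv ℝ fun y => fderiv ℝ f y v) x w w =
      fderiv ℝ (fun y => fderiv ℝ (fderiv ℝ f) y w w) x v := fun w => by
    have hvw : (fun y => fderiv ℝ (fun y => fderiv ℝ f y v) y w) =ᶠ[𝓝 x]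
        fun y => fderiv ℝ (fun y => fderiv ℝ f y w) y v := by
      filter_upwards [hf₂.eventually (by simp)] with y hy
      rw [fderiv_fderiv_apply hy, fderiv_fderiv_apply hy, (hy.isSymmSndFDerivAt (by simp)) w v]
    have hww : (fun y => fderiv ℝ (fun y => fderiv ℝ f y w) y w) =ᶠ[𝓝 x]
        fun y => fderiv ℝ (fderiv ℝ f) y w w := by
      filter_upwards [hf₂.eventually (by simp)] with y hy using fderiv_fderiv_apply hy w w
    rw [← fderiv_fderiv_apply (hdir v), hvw.fderiv_eq, fderiv_fderiv_apply (hdir w),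
      ((hdir w).isSymmSndFDerivAt (by simp)) w v, ← fderiv_fderiv_apply (hdir w), hww.fderiv_eq]
  have hdiff : ∀ w, DifferentiableAt ℝ (fun y => fderiv ℝ (fderiv ℝ f) y w w) x := fun w =>
    ((((hf.fderiv_right (m := 2) (by norm_num)).fderiv_right (m := 1)
      (by norm_num)).clm_apply contDiffAt_const).clm_apply
        contDiffAt_const).differentiableAt one_ne_zero
  have hΔ : Δ f = fun y => ∑ i, fderiv ℝ (fderiv ℝ f) y (stdOrthonormalBasis ℝ E i)
      (stdOrthonormalBasis ℝ E i) := funext (laplacian_eq_sum _ f)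
  rw [laplacian_eq_sum (stdOrthonormalBasis ℝ E), hΔ, fderiv_fun_sum fun i _ => hdiff _]
  simp [hsymm]

theorem exists_radial_bump {x : E} (hx : x ≠ 0) :
    ∃ χ : E → ℝ, ContDiff ℝ 1 χ ∧ HasCompactSupport χ ∧ 0 ∉ tsupport χ ∧ (∀ y, 0 ≤ χ y) ∧
      χ x = 1 ∧ ∀ y, ∃ c : ℝ, fderiv ℝ χ y = c • innerSL ℝ y := by
  have hR : 0 < ‖x‖ ^ 2 := by positivity
  let η : ContDiffBump (‖x‖ ^ 2) := ⟨‖x‖ ^ 2 / 4, ‖x‖ ^ 2 / 2, by positivity, by linarith⟩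
  have hsupp : tsupport (fun y : E => η (‖y‖ ^ 2)) ⊆
      (fun y => ‖y‖ ^ 2) ⁻¹' Metric.closedBall (‖x‖ ^ 2) (‖x‖ ^ 2 / 2) := by
    rw [← η.tsupport_eq]
    exact tsupport_comp_subset_preimage η (by fun_prop)
  refine ⟨fun y => η (‖y‖ ^ 2), η.contDiff.comp (contDiff_norm_sq ℝ), ?_, fun h => ?_,
    fun _ => η.nonneg, η.one_of_mem_closedBall (Metric.mem_closedBall_self (by positivity)),
    fun y => ⟨2 * deriv η (‖y‖ ^ 2), ?_⟩⟩
  · refine (isCompact_closedBall (0 : E) (2 * ‖x‖)).of_isClosed_subset (isClosed_tsupport _)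
      fun y hy => ?_
    have := hsupp hy
    rw [Set.mem_preimage, Metric.mem_closedBall, Real.dist_eq, abs_le] at this
    rw [mem_closedBall_zero_iff]
    nlinarith [norm_nonneg x, norm_nonneg y]
  · have := hsupp h
    rw [Set.mem_preimage, Metric.mem_closedBall, Real.dist_eq, abs_le] at this
    simp only [norm_zero] at this
    linarith
  · have d : HasFDerivAt (fun y : E => η (‖y‖ ^ 2)) (deriv η (‖y‖ ^ 2) • (2 • innerSL ℝ y)) y :=
      (η.contDiff.differentiable (n := 1) (by simp) _).hasDerivAt.comp_hasFDerivAt y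
        (hasStrictFDerivAt_norm_sq y).hasFDerivAt
    rw [d.fderiv]
    module

theorem continuous_mul_of_continuousAt {X : Type*} [TopologicalSpace X] {χ w : X → ℝ}
    (hχ : Continuous χ) (hw : ∀ x ∈ tsupport χ, ContinuousAt w x) :
    Continuous fun x => χ x * w x :=
  continuous_of_tsupport fun x hx => hχ.continuousAt.mul (hw x (tsupport_mul_subset_left hx))

theorem integrable_mul_of_continuousAt {X : Type*} [TopologicalSpace X] [MeasurableSpace X]
    [OpensMeasurableSpace X] {μ : Measure X} [IsFiniteMeasureOnCompacts μ] {χ w : X → ℝ}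
    (hχ : Continuous χ) (hs : HasCompactSupport χ) (hw : ∀ x ∈ tsupport χ, ContinuousAt w x) :
    Integrable (fun x => χ x * w x) μ :=
  (continuous_mul_of_continuousAt hχ hw).integrable_of_hasCompactSupport hs.mul_right

section Integral

variable [MeasurableSpace E] [BorelSpace E] (μ : Measure E) [μ.IsAddHaarMeasure]

theorem integral_mul_fderiv_fderiv {χ u : E → ℝ} (hχ : ContDiff ℝ 1 χ) (hs : HasCompactSupport χ)
    (hu : ∀ x ∈ tsupport χ, ContDiffAt ℝ 2 u x) (v : E) :
    ∫ x, χ x * fderiv ℝ (fderiv ℝ u) x v v ∂μ = -∫ x, fderiv ℝ χ x v * fderiv ℝ u x v ∂μ := by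
  have hu' : ∀ x ∈ tsupport χ, DifferentiableAt ℝ (fun y => fderiv ℝ u y v) x := fun x hx =>
    (differentiableAt_fderiv (hu x hx)).clm_apply (differentiableAt_const v)
  have hu'' : ∀ x, χ x * fderiv ℝ (fun y => fderiv ℝ u y v) x v =
      χ x * fderiv ℝ (fderiv ℝ u) x v v := fun x => by
    by_cases hx : x ∈ tsupport χ
    · rw [fderiv_fderiv_apply (hu x hx)]
    · rw [image_eq_zero_of_notMem_tsupport hx, zero_mul, zero_mul]
  simp only [← hu'']
  refine integral_mul_fderiv_eq_neg_fderiv_mul_of_integrable ?_ ?_ ?_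
    (fun x _ => hχ.differentiable one_ne_zero x) hu'
  · exact integrable_mul_of_continuousAt
      ((hχ.continuous_fderiv one_ne_zero).clm_apply continuous_const) (hs.fderiv_apply ℝ v)
      fun x hx => (hu' x (tsupport_fderiv_apply_subset ℝ v hx)).continuousAt
  · simp only [hu'']
    exact integrable_mul_of_continuousAt hχ.continuous hs fun x hx =>
      continuousAt_fderiv_fderiv_apply (hu x hx) v v
  · exact integrable_mul_of_continuousAt hχ.continuous hs fun x hx => (hu' x hx).continuousAt

theorem integral_mul_laplacian_eq_zero {χ u : E → ℝ} (hχ : ContDiff ℝ 1 χ)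
    (hs : HasCompactSupport χ) (hχ₀ : 0 ∉ tsupport χ)
    (hrad : ∀ x, ∃ c : ℝ, fderiv ℝ χ x = c • innerSL ℝ x)
    (hu : IsSmoothOffZero u) (h₀ : IsHomogeneous 0 u) : ∫ x, χ x * Δ u x ∂μ = 0 := by
  let b := stdOrthonormalBasis ℝ E
  have hu₂ : ∀ x ∈ tsupport χ, ContDiffAt ℝ 2 u x := fun x hx =>
    hu.contDiffAt_two fun h => hχ₀ (h ▸ hx)
  have hgrad : ∀ x, ∑ i, fderiv ℝ χ x (b i) * fderiv ℝ u x (b i) = 0 := fun x => by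
    obtain ⟨c, hc⟩ := hrad x
    rcases eq_or_ne x 0 with rfl | hx
    · simp [hc]
    calc ∑ i, fderiv ℝ χ x (b i) * fderiv ℝ u x (b i)
        = c * fderiv ℝ u x (∑ i, inner ℝ (b i) x • b i) := by
          simp [hc, real_inner_comm x, Finset.mul_sum, mul_assoc]
      _ = 0 := by
          rw [b.sum_repr' x, h₀.fderiv_apply_self hx (hu.differentiableAt hx)]
          simp
  calc ∫ x, χ x * Δ u x ∂μ
      = ∑ i, ∫ x, χ x * fderiv ℝ (fderiv ℝ u) x (b i) (b i) ∂μ := by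
        rw [← integral_finsetSum _ fun i _ => integrable_mul_of_continuousAt hχ.continuous hs
          fun x hx => continuousAt_fderiv_fderiv_apply (hu₂ x hx) _ _]
        simp only [laplacian_eq_sum b, Finset.mul_sum]
    _ = -∫ x, ∑ i, fderiv ℝ χ x (b i) * fderiv ℝ u x (b i) ∂μ := by
        rw [integral_finsetSum _ fun i _ => integrable_mul_of_continuousAt
          ((hχ.continuous_fderiv one_ne_zero).clm_apply continuous_const) (hs.fderiv_apply ℝ _)
          fun x hx => ((differentiableAt_fderiv (hu₂ x
            (tsupport_fderiv_apply_subset ℝ _ hx))).clm_apply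
              (differentiableAt_const _)).continuousAt]
        simp only [integral_mul_fderiv_fderiv μ hχ hs hu₂, Finset.sum_neg_distrib]
    _ = 0 := by simp [hgrad]

end Integral

theorem laplacian_eq_zero_of_nonneg {u : E → ℝ} (hu : IsSmoothOffZero u)
    (h₀ : IsHomogeneous 0 u) (hΔ : ∀ x, x ≠ 0 → 0 ≤ Δ u x) {x : E} (hx : x ≠ 0) :
    Δ u x = 0 := by
  let _ : MeasurableSpace E := borel E
  have : BorelSpace E := ⟨rfl⟩
  obtain ⟨χ, hχ, hs, hχ₀, hpos, hone, hrad⟩ := exists_radial_bump hx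
  have hcont : Continuous fun y => χ y * Δ u y :=
    continuous_mul_of_continuousAt hχ.continuous fun y hy => by
      simp only [funext (laplacian_eq_sum (stdOrthonormalBasis ℝ E) u)]
      exact tendsto_finsetSum _ fun i _ => continuousAt_fderiv_fderiv_apply
        (hu.contDiffAt_two fun h => hχ₀ (h ▸ hy)) _ _
  have hnonneg : ∀ y, 0 ≤ χ y * Δ u y := fun y => by
    rcases eq_or_ne y 0 with rfl | hy
    · simp [image_eq_zero_of_notMem_tsupport hχ₀]
    · exact mul_nonneg (hpos y) (hΔ y hy)
  by_contra hne
  exact (hcont.integral_pos_of_hasCompactSupport_nonneg_nonzero (μ := volume) (x := x)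
    hs.mul_right hnonneg (by simpa [hone] using hne)).ne'
    (integral_mul_laplacian_eq_zero volume hχ hs hχ₀ hrad hu h₀)

variable [NormedAddCommGroup F] [InnerProductSpace ℝ F]

theorem fderiv_eq_zero_of_laplacian_eq_zero {u : E → F} (hu : IsSmoothOffZero u)
    (h₀ : IsHomogeneous 0 u) (hΔ : ∀ x, x ≠ 0 → Δ u x = 0) {x : E} (hx : x ≠ 0) :
    fderiv ℝ u x = 0 := by
  let b := stdOrthonormalBasis ℝ E
  have hΔsq : ∀ y, y ≠ 0 → Δ (fun z => ‖u z‖ ^ 2) y = 2 * ∑ i, ‖fderiv ℝ u y (b i)‖ ^ 2 :=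
    fun y hy => by simp [laplacian_norm_sq b (hu.contDiffAt_two hy), hΔ y hy]
  have hsq : Δ (fun z => ‖u z‖ ^ 2) x = 0 :=
    laplacian_eq_zero_of_nonneg (fun y hy => (hu y hy).norm_sq ℝ)
      (fun y hy r hr => by simp [h₀ y hy r hr])
      (fun y hy => by rw [hΔsq y hy]; positivity) hx
  rw [hΔsq x hx, mul_eq_zero_iff_left two_ne_zero,
    Finset.sum_eq_zero_iff_of_nonneg fun i _ => by positivity] at hsq
  exact ContinuousLinearMap.coe_injective (b.toBasis.ext fun i => by
    simpa using hsq i (Finset.mem_univ i))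

theorem eq_of_laplacian_eq_zero (hE : 1 < Module.finrank ℝ E) {u : E → F}
    (hu : IsSmoothOffZero u) (h₀ : IsHomogeneous 0 u) (hΔ : ∀ x, x ≠ 0 → Δ u x = 0) {x y : E}
    (hx : x ≠ 0) (hy : y ≠ 0) : u x = u y := by
  have hconn : IsPreconnected ({0}ᶜ : Set E) :=
    (isConnected_compl_singleton_of_one_lt_rank
      (by rw [← Module.finrank_eq_rank]; exact_mod_cast hE) 0).isPreconnected
  exact isOpen_compl_singleton.is_const_of_fderiv_eq_zero (𝕜 := ℝ) hconn
    (fun z hz => (hu.differentiableAt hz).differentiableWithinAt)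
    (fun z hz => fderiv_eq_zero_of_laplacian_eq_zero hu h₀ hΔ hz) hx hy

theorem exists_clm_of_laplacian_eq_zero (hE : 1 < Module.finrank ℝ E) {f : E → F}
    (hf : IsSmoothOffZero f) (h₁ : IsHomogeneous 1 f) (hΔ : ∀ x, x ≠ 0 → Δ f x = 0) :
    ∃ A : E →L[ℝ] F, ∀ x, x ≠ 0 → f x = A x := by
  have : Nontrivial E := Module.nontrivial_of_finrank_pos (zero_lt_one.trans hE)
  obtain ⟨x₀, hx₀⟩ := exists_ne (0 : E)
  have hΔ' : ∀ v y, y ≠ 0 → Δ (fun z => fderiv ℝ f z v) y = 0 := fun v y hy => by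
    have hzero : Δ f =ᶠ[𝓝 y] fun _ => 0 := by
      filter_upwards [isOpen_ne.mem_nhds hy] with z hz using hΔ z hz
    rw [laplacian_fderiv_apply ((hf y hy).of_le (WithTop.coe_le_coe.2 le_top)), hzero.fderiv_eq]
    simp
  refine ⟨fderiv ℝ f x₀, fun x hx => ?_⟩
  calc f x = fderiv ℝ f x x := by
        simpa using (h₁.fderiv_apply_self hx (hf.differentiableAt hx)).symm
    _ = fderiv ℝ f x₀ x := eq_of_laplacian_eq_zero hE (hf.fderiv_apply x)
        (h₁.fderiv_apply x) (hΔ' x) hx hx₀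

end Homogeneous

/-! ### Curvature and geodesics of the sphere -/

section SphereGeometry

open Filter Topology

variable {n : ℕ}

theorem sphere_norm (p : Sph n) : ‖(p : Eucl (n + 1))‖ = 1 := by
  simp

theorem sphere_inner_self (p : Sph n) : inner ℝ (p : Eucl (n + 1)) (p : Eucl (n + 1)) = 1 := by
  rw [real_inner_self_eq_norm_sq, sphere_norm, one_pow]

theorem sphere_ne_zero (p : Sph n) : (p : Eucl (n + 1)) ≠ 0 :=
  norm_ne_zero_iff.1 ((sphere_norm p).trans_ne one_ne_zero)

/-- The map `tangentPart p` as a continuous linear map. -/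
def tangentProj (p : Eucl (n + 1)) : Eucl (n + 1) →L[ℝ] Eucl (n + 1) :=
  ContinuousLinearMap.id ℝ _ - (innerSL ℝ p).smulRight p

theorem tangentProj_apply (p w : Eucl (n + 1)) : tangentProj p w = tangentPart p w := rfl

theorem tangentPart_of_inner_eq_zero {p w : Eucl (n + 1)} (h : inner ℝ p w = 0) :
    tangentPart p w = w := by
  simp [tangentPart, h]

theorem tangentPart_self {p : Eucl (n + 1)} (hp : inner ℝ p p = 1) : tangentPart p p = 0 := by
  rw [tangentPart, hp, one_smul, sub_self]

theorem inner_tangentPart {p w v : Eucl (n + 1)} (hv : inner ℝ p v = 0) :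
    inner ℝ (tangentPart p w) v = inner ℝ w v := by
  simp [tangentPart, inner_sub_left, inner_smul_left, hv]

theorem inner_fderiv_add_inner_fderiv {E F : Type*} [NormedAddCommGroup E] [NormedSpace ℝ E]
    [NormedAddCommGroup F] [InnerProductSpace ℝ F] {f g : E → F} {x : E}
    (hf : DifferentiableAt ℝ f x) (hg : DifferentiableAt ℝ g x) {c : ℝ}
    (h : ∀ᶠ y in 𝓝 x, inner ℝ (f y) (g y) = c) (u : E) :
    inner ℝ (f x) (fderiv ℝ g x u) + inner ℝ (fderiv ℝ f x u) (g x) = 0 := by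
  have hconst : (fun y => inner ℝ (f y) (g y)) =ᶠ[𝓝 x] fun _ => c := h
  rw [← fderiv_inner_apply ℝ hf hg, hconst.fderiv_eq, fderiv_fun_const]
  rfl

theorem inner_fderiv_self_eq_zero {E F : Type*} [NormedAddCommGroup E] [NormedSpace ℝ E]
    [NormedAddCommGroup F] [InnerProductSpace ℝ F] {f : E → F} {x : E}
    (hf : DifferentiableAt ℝ f x) {c : ℝ} (h : ∀ᶠ y in 𝓝 x, inner ℝ (f y) (f y) = c) (u : E) :
    inner ℝ (f x) (fderiv ℝ f x u) = 0 := by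
  have := inner_fderiv_add_inner_fderiv hf hf h u
  rw [real_inner_comm (f x)] at this
  linarith

theorem tangentPart_fderiv_tangentPart {E : Type*} [NormedAddCommGroup E] [NormedSpace ℝ E]
    {Φ G : E → Eucl (n + 1)} {x u : E} (hΦ : DifferentiableAt ℝ Φ x)
    (hG : DifferentiableAt ℝ G x) (h₁ : inner ℝ (Φ x) (Φ x) = 1)
    (h₀ : inner ℝ (Φ x) (fderiv ℝ Φ x u) = 0) :
    tangentPart (Φ x) (fderiv ℝ (fun y => tangentPart (Φ y) (G y)) x u) =
      tangentPart (Φ x) (fderiv ℝ G x u) - inner ℝ (Φ x) (G x) • fderiv ℝ Φ x u := by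
  have hd : HasFDerivAt (fun y => tangentPart (Φ y) (G y)) _ x :=
    hG.hasFDerivAt.fun_sub ((hΦ.hasFDerivAt.inner ℝ hG.hasFDerivAt).fun_smul hΦ.hasFDerivAt)
  rw [hd.fderiv]
  simp only [← tangentProj_apply, sub_apply, add_apply, smul_apply,
    ContinuousLinearMap.smulRight_apply, map_sub, map_add, map_smul]
  simp [tangentProj_apply, tangentPart_self h₁, tangentPart_of_inner_eq_zero h₀]

theorem tangentExtension_self {p w : Eucl (n + 1)} (h : inner ℝ p w = 0) :
    tangentExtension w p = w :=
  tangentPart_of_inner_eq_zero h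

theorem hasFDerivAt_tangentExtension (w q : Eucl (n + 1)) :
    HasFDerivAt (tangentExtension w)
      (-((innerSL ℝ w).smulRight q) - inner ℝ q w • ContinuousLinearMap.id ℝ _) q := by
  have h : HasFDerivAt (fun q : Eucl (n + 1) => inner ℝ q w) (innerSL ℝ w) q :=
    (innerSL ℝ w).hasFDerivAt.congr_of_eventuallyEq (.of_forall fun y => real_inner_comm w y)
  refine ((hasFDerivAt_const w q).fun_sub (h.fun_smul (hasFDerivAt_id q))).congr_fderiv ?_
  ext1 v
  simp
  abel

theorem fderiv_tangentExtension (w q v : Eucl (n + 1)) :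
    fderiv ℝ (tangentExtension w) q v = -(inner ℝ w v • q) - inner ℝ q w • v := by
  rw [(hasFDerivAt_tangentExtension w q).fderiv]
  simp

theorem sphereNabla_sphereNabla {p a b c : Eucl (n + 1)} (hp : inner ℝ p p = 1)
    (ha : inner ℝ p a = 0) (hb : inner ℝ p b = 0) (hc : inner ℝ p c = 0) :
    sphereNabla (tangentExtension a)
      (sphereNabla (tangentExtension b) (tangentExtension c)) p = -(inner ℝ a c • b) := by
  have dY := (hasFDerivAt_tangentExtension b p).differentiableAt
  let G : Eucl (n + 1) → Eucl (n + 1) := fun q =>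
    -(inner ℝ c (tangentExtension b q) • q) - inner ℝ q c • tangentExtension b q
  have hG : sphereNabla (tangentExtension b) (tangentExtension c) =
      fun q => tangentPart (id q) (G q) := by
    ext1 q
    simp [sphereNabla, fderiv_tangentExtension, G]
  have hd : HasFDerivAt G _ p :=
    ((((hasFDerivAt_const c p).inner ℝ dY.hasFDerivAt).fun_smul (hasFDerivAt_id p)).fun_neg).fun_sub
      (((hasFDerivAt_id p).inner ℝ (hasFDerivAt_const c p)).fun_smul dY.hasFDerivAt)
  have hnabla := tangentPart_fderiv_tangentPart (Φ := id) (u := tangentExtension a p)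
    differentiableAt_id hd.differentiableAt hp (by simpa [tangentExtension_self ha] using ha)
  rw [id_eq, hd.fderiv, tangentExtension_self ha] at hnabla
  rw [sphereNabla, hG, tangentExtension_self ha, hnabla]
  have hp' : tangentProj p p = 0 := tangentPart_self hp
  have ha' : tangentProj p a = a := tangentPart_of_inner_eq_zero ha
  have hb' : tangentProj p b = b := tangentPart_of_inner_eq_zero hb
  simp [← tangentProj_apply, G, tangentExtension_self hb, hp', ha', hb', hc, inner_sub_right,
    inner_smul_right, hb, real_inner_comm c, hp, -inner_self_eq_norm_sq_to_K]
  abel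

theorem sphereCurvature_eq (p : Sph n) {a b c : Eucl (n + 1)}
    (ha : inner ℝ (p : Eucl (n + 1)) a = 0) (hb : inner ℝ (p : Eucl (n + 1)) b = 0)
    (hc : inner ℝ (p : Eucl (n + 1)) c = 0) :
    sphereCurvature p a b c = inner ℝ a c • b - inner ℝ b c • a := by
  have hbracket : VectorField.lieBracket ℝ (tangentExtension a) (tangentExtension b)
      (p : Eucl (n + 1)) = 0 := by
    rw [VectorField.lieBracket, fderiv_tangentExtension, fderiv_tangentExtension,
      tangentExtension_self ha, tangentExtension_self hb]
    simp [ha, hb, real_inner_comm a b]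
  have hnabla : sphereNabla (VectorField.lieBracket ℝ (tangentExtension a) (tangentExtension b))
      (tangentExtension c) p = 0 := by
    rw [sphereNabla, hbracket, map_zero, ← tangentProj_apply, map_zero]
  simp only [sphereCurvature, hnabla, sphereNabla_sphereNabla (sphere_inner_self p) ha hb hc,
    sphereNabla_sphereNabla (sphere_inner_self p) hb ha hc]
  abel

end SphereGeometry

section GreatCircle

variable {E : Type*} [NormedAddCommGroup E] [InnerProductSpace ℝ E]

theorem eq_zero_of_oscillator {k : ℝ} {f f' : ℝ → E} (h : ∀ t, HasDerivAt f (f' t) t)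
    (h' : ∀ t, HasDerivAt f' (-(k ^ 2 • f t)) t) (h₀ : f 0 = 0) (h₀' : f' 0 = 0) (t : ℝ) :
    f t = 0 := by
  have henergy : ∀ t, HasDerivAt (fun t => ‖f' t‖ ^ 2 + k ^ 2 * ‖f t‖ ^ 2) 0 t := by
    intro t
    refine ((h' t).norm_sq.fun_add ((h t).norm_sq.const_mul (k ^ 2))).congr_deriv ?_
    simp only [inner_neg_right, inner_smul_right, real_inner_comm (f t)]
    ring
  have hf' : ∀ t, f' t = 0 := fun t => by
    have hconst := is_const_of_deriv_eq_zero (fun t => (henergy t).differentiableAt)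
      (fun t => (henergy t).deriv) t 0
    have hsq : ‖f' t‖ ^ 2 ≤ 0 := by
      simp only [h₀, h₀', norm_zero] at hconst
      nlinarith [mul_nonneg (sq_nonneg k) (sq_nonneg ‖f t‖)]
    exact norm_eq_zero.1 (pow_eq_zero_iff two_ne_zero |>.1 (hsq.antisymm (sq_nonneg _)))
  rw [is_const_of_deriv_eq_zero (fun t => (h t).differentiableAt)
    (fun t => by rw [(h t).deriv, hf' t]) t 0, h₀]

/-- The great circle `t ↦ exp_p (t v)`, for a unit vector `p` and `v` orthogonal to `p`. For
`v = 0` the quotient is `0`, which is harmless as it multiplies `v`. -/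
def greatCircle (p v : E) (t : ℝ) : E :=
  Real.cos (‖v‖ * t) • p + (Real.sin (‖v‖ * t) / ‖v‖) • v

/-- The velocity of the great circle. -/
def greatCircleVelocity (p v : E) (t : ℝ) : E :=
  -((‖v‖ * Real.sin (‖v‖ * t)) • p) + Real.cos (‖v‖ * t) • v

theorem hasDerivAt_greatCircle (p v : E) (t : ℝ) :
    HasDerivAt (greatCircle p v) (greatCircleVelocity p v t) t := by
  have hlin : HasDerivAt (fun t => ‖v‖ * t) ‖v‖ t := by
    simpa using (hasDerivAt_id t).const_mul ‖v‖
  refine ((hlin.cos.smul_const p).fun_add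
    ((hlin.sin.div_const ‖v‖).smul_const v)).congr_deriv ?_
  rcases eq_or_ne v 0 with rfl | hv
  · simp [greatCircleVelocity]
  · rw [greatCircleVelocity, mul_div_assoc, div_self (norm_ne_zero_iff.2 hv), mul_one, neg_mul,
      neg_smul, mul_comm (Real.sin _)]

theorem hasDerivAt_greatCircleVelocity (p v : E) (t : ℝ) :
    HasDerivAt (greatCircleVelocity p v) (-(‖v‖ ^ 2 • greatCircle p v t)) t := by
  have hlin : HasDerivAt (fun t => ‖v‖ * t) ‖v‖ t := by
    simpa using (hasDerivAt_id t).const_mul ‖v‖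
  refine (((hlin.sin.const_mul ‖v‖).smul_const p).fun_neg.fun_add
    (hlin.cos.smul_const v)).congr_deriv ?_
  rcases eq_or_ne v 0 with rfl | hv
  · simp
  have hv' := norm_ne_zero_iff.2 hv
  rw [greatCircle]
  match_scalars
  · ring
  · field_simp

theorem norm_greatCircle {p v : E} (hp : ‖p‖ = 1) (hv : inner ℝ p v = 0) (t : ℝ) :
    ‖greatCircle p v t‖ = 1 := by
  rcases eq_or_ne v 0 with rfl | h₀
  · simp [greatCircle, hp]
  have h₀ := norm_ne_zero_iff.2 h₀
  have hsq : ‖greatCircle p v t‖ ^ 2 = 1 := by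
    rw [greatCircle, norm_add_sq_real, real_inner_smul_left, real_inner_smul_right, hv, norm_smul,
      norm_smul, mul_pow, mul_pow, Real.norm_eq_abs, Real.norm_eq_abs, sq_abs, sq_abs, hp, div_pow,
      div_mul_cancel₀ _ (pow_ne_zero 2 h₀)]
    linear_combination Real.cos_sq_add_sin_sq (‖v‖ * t)
  exact (pow_eq_one_iff_of_nonneg (norm_nonneg _) two_ne_zero).1 hsq

theorem greatCircle_smul (p v : E) (t : ℝ) : greatCircle p (t • v) 1 = greatCircle p v t := by
  rcases eq_or_ne t 0 with rfl | ht
  · simp [greatCircle]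
  rcases abs_choice t with h | h <;>
    simp [greatCircle, norm_smul, smul_smul, h, mul_comm t, div_mul_eq_mul_div,
      mul_div_mul_right _ _ ht]

end GreatCircle

section Geodesic

variable {n : ℕ}

theorem IsGeodesic.hasDerivAt {γ : ℝ → Sph n} (hγ : IsGeodesic γ) (t : ℝ) :
    HasDerivAt (fun s => (γ s : Eucl (n + 1))) (deriv (fun s => (γ s : Eucl (n + 1))) t) t :=
  (hγ.1.differentiable (by simp) t).hasDerivAt

theorem IsGeodesic.hasDerivAt_deriv {γ : ℝ → Sph n} (hγ : IsGeodesic γ) (t : ℝ) :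
    HasDerivAt (deriv fun s => (γ s : Eucl (n + 1)))
      (deriv (deriv fun s => (γ s : Eucl (n + 1))) t) t :=
  ((contDiff_infty_iff_deriv.1 hγ.1).2.differentiable (by simp) t).hasDerivAt

theorem IsGeodesic.inner_deriv {γ : ℝ → Sph n} (hγ : IsGeodesic γ) (t : ℝ) :
    inner ℝ (γ t : Eucl (n + 1)) (deriv (fun s => (γ s : Eucl (n + 1))) t) = 0 :=
  inner_fderiv_self_eq_zero (hγ.hasDerivAt t).differentiableAt
    (.of_forall fun s => sphere_inner_self (γ s)) 1

theorem IsGeodesic.deriv_deriv {γ : ℝ → Sph n} (hγ : IsGeodesic γ) (t : ℝ) :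
    deriv (deriv fun s => (γ s : Eucl (n + 1))) t =
      -(‖deriv (fun s => (γ s : Eucl (n + 1))) t‖ ^ 2 • (γ t : Eucl (n + 1))) := by
  have hnormal : inner ℝ (γ t : Eucl (n + 1)) (deriv (deriv fun s => (γ s : Eucl (n + 1))) t)
      + ‖deriv (fun s => (γ s : Eucl (n + 1))) t‖ ^ 2 = 0 := by
    rw [← real_inner_self_eq_norm_sq]
    exact inner_fderiv_add_inner_fderiv (hγ.hasDerivAt t).differentiableAt
      (hγ.hasDerivAt_deriv t).differentiableAt (.of_forall hγ.inner_deriv) 1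
  rw [← neg_smul, ← eq_neg_of_add_eq_zero_left hnormal]
  exact sub_eq_zero.1 (hγ.2 t)

theorem IsGeodesic.norm_deriv {γ : ℝ → Sph n} (hγ : IsGeodesic γ) (t : ℝ) :
    ‖deriv (fun s => (γ s : Eucl (n + 1))) t‖ ^ 2 =
      ‖deriv (fun s => (γ s : Eucl (n + 1))) 0‖ ^ 2 := by
  have hd : ∀ t, HasDerivAt (fun s => ‖deriv (fun s => (γ s : Eucl (n + 1))) s‖ ^ 2) 0 t :=
    fun t => (hγ.hasDerivAt_deriv t).norm_sq.congr_deriv <| by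
      rw [hγ.deriv_deriv, inner_neg_right, real_inner_smul_right, real_inner_comm, hγ.inner_deriv]
      simp
  exact is_const_of_deriv_eq_zero (fun t => (hd t).differentiableAt) (fun t => (hd t).deriv) t 0

theorem IsGeodesic.eq_greatCircle {γ : ℝ → Sph n} (hγ : IsGeodesic γ) (t : ℝ) :
    (γ t : Eucl (n + 1)) =
      greatCircle (γ 0 : Eucl (n + 1)) (deriv (fun s => (γ s : Eucl (n + 1))) 0) t := by
  set v := deriv (fun s => (γ s : Eucl (n + 1))) 0 with hv
  refine sub_eq_zero.1 (eq_zero_of_oscillator (k := ‖v‖)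
    (fun t => (hγ.hasDerivAt t).fun_sub (hasDerivAt_greatCircle (γ 0 : Eucl (n + 1)) v t))
    (fun t => ((hγ.hasDerivAt_deriv t).fun_sub
      (hasDerivAt_greatCircleVelocity (γ 0 : Eucl (n + 1)) v t)).congr_deriv ?_)
    (by simp [greatCircle]) (by simp [greatCircleVelocity, ← hv]) t)
  rw [hγ.deriv_deriv, hγ.norm_deriv, ← hv, smul_sub]
  abel

theorem exists_isGeodesic (p : Sph n) {v : Eucl (n + 1)}
    (hv : inner ℝ (p : Eucl (n + 1)) v = 0) :
    ∃ γ : ℝ → Sph n, IsGeodesic γ ∧ γ 0 = p ∧ deriv (fun t => (γ t : Eucl (n + 1))) 0 = v := by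
  have hd : deriv (greatCircle (p : Eucl (n + 1)) v) = greatCircleVelocity (p : Eucl (n + 1)) v :=
    funext fun t => (hasDerivAt_greatCircle _ _ t).deriv
  have hs : ContDiff ℝ ∞ (greatCircle (p : Eucl (n + 1)) v) := by
    unfold greatCircle
    fun_prop
  have hnorm := norm_greatCircle (sphere_norm p) hv
  refine ⟨fun t => ⟨greatCircle p v t, by simpa using hnorm t⟩, ⟨hs, fun t => ?_⟩, ?_, ?_⟩
  · change tangentPart (greatCircle (p : Eucl (n + 1)) v t)
      (deriv (deriv (greatCircle (p : Eucl (n + 1)) v)) t) = 0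
    rw [hd, (hasDerivAt_greatCircleVelocity _ _ t).deriv, ← neg_smul, ← tangentProj_apply,
      map_smul, tangentProj_apply, tangentPart_self, smul_zero]
    rw [real_inner_self_eq_norm_sq, hnorm, one_pow]
  · ext1
    simp [greatCircle]
  · exact (congrFun hd 0).trans (by simp [greatCircleVelocity])

theorem sphereExp_eq (p : Sph n) {v : Eucl (n + 1)} (hv : inner ℝ (p : Eucl (n + 1)) v = 0) :
    (sphereExp p v : Eucl (n + 1)) = greatCircle (p : Eucl (n + 1)) v 1 := by
  have h := exists_isGeodesic p hv
  obtain ⟨hγ, h₀, h₁⟩ := h.choose_spec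
  rw [sphereExp, dif_pos h, hγ.eq_greatCircle, h₀, h₁]

theorem expVariation_eq {M : Type*} {φ : M → Sph n} {V : M → Eucl (n + 1)}
    (hV : ∀ x, inner ℝ (φ x : Eucl (n + 1)) (V x) = 0) (t : ℝ) (x : M) :
    (expVariation φ V t x : Eucl (n + 1)) = greatCircle (φ x : Eucl (n + 1)) (V x) t := by
  rw [expVariation, sphereExp_eq _ (by rw [real_inner_smul_right, hV, mul_zero]),
    greatCircle_smul]

end Geodesic

/-! ### The Laplacian of vector-valued maps -/

section MapLaplacian

open Filter Topology

variable {m : ℕ} {M : Type*} [TopologicalSpace M] [ChartedSpace (Eucl m) M]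
  {F G : Type*} [NormedAddCommGroup F] [NormedSpace ℝ F] [NormedAddCommGroup G] [NormedSpace ℝ G]

@[simp] theorem inChart_center {W : Type*} (x : M) (f : M → W) :
    inChart (m := m) x f (center x) = f x := by
  simp [inChart, center]

theorem contDiffAt_inChart {k : WithTop ℕ∞} {f : M → F} {x : M}
    (hf : ContMDiffAt (𝓡 m) 𝓘(ℝ, F) k f x) :
    ContDiffAt ℝ k (inChart (m := m) x f) (center x) := by
  have h := (contMDiffAt_iff.1 hf).2
  simp only [ModelWithCorners.range_eq_univ, contDiffWithinAt_univ] at h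
  exact h

theorem fderiv_inChart {f : M → F} {x : M} (hf : MDifferentiableAt (𝓡 m) 𝓘(ℝ, F) f x)
    (u : Eucl m) : fderiv ℝ (inChart x f) (center x) u = mfderiv (𝓡 m) 𝓘(ℝ, F) f x u := by
  rw [hf.mfderiv]
  simp only [ModelWithCorners.range_eq_univ, fderivWithin_univ]
  rfl

theorem inChart_eventuallyEq {W : Type*} {f h : M → W} {x : M} (hfh : f =ᶠ[𝓝 x] h) :
    inChart (m := m) x f =ᶠ[𝓝 (center x)] inChart x h :=
  (continuousAt_extChartAt_symm (I := 𝓡 m) x).eventually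
    (p := fun y => f y = h y) (by simpa using hfh.eventually)

variable [IsManifold (𝓡 m) ∞ M]

/-- The componentwise Laplacian `trace ∇df` of a vector-valued map. -/
def mapLaplacian (g : SmoothMetric m M) (f : M → F) (x : M) : F :=
  secondOrderOp (frame g x) (∑ i, christoffel g x (frame g x i) (frame g x i)) (inChart x f)
    (center x)

/-- The derivative `df(e_i)` of a vector-valued map along the orthonormal frame at `x`. -/
def frameDeriv (g : SmoothMetric m M) (f : M → F) (x : M) (i : Fin m) : F :=
  fderiv ℝ (inChart x f) (center x) (frame g x i)

variable (g : SmoothMetric m M) {x : M}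

theorem laplacian_eq_mapLaplacian {f : M → ℝ} (hf : ContMDiffAt (𝓡 m) 𝓘(ℝ, ℝ) 2 f x) :
    laplacian g f x = mapLaplacian g f x := by
  simp [laplacian, mapLaplacian, secondOrderOp, fderiv_fderiv_apply (contDiffAt_inChart hf)]

theorem mapLaplacian_congr {f h : M → F} (hfh : f =ᶠ[𝓝 x] h) :
    mapLaplacian g f x = mapLaplacian g h x := by
  have := inChart_eventuallyEq (m := m) hfh
  rw [mapLaplacian, secondOrderOp, this.fderiv.fderiv_eq, this.fderiv_eq]
  rfl

theorem mapLaplacian_const (a : F) : mapLaplacian g (fun _ => a) x = 0 :=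
  secondOrderOp_const a _ _ _

theorem mapLaplacian_add {f h : M → F} (hf : ContMDiffAt (𝓡 m) 𝓘(ℝ, F) 2 f x)
    (hh : ContMDiffAt (𝓡 m) 𝓘(ℝ, F) 2 h x) :
    mapLaplacian g (fun y => f y + h y) x = mapLaplacian g f x + mapLaplacian g h x :=
  secondOrderOp_add (contDiffAt_inChart hf) (contDiffAt_inChart hh) _ _

theorem mapLaplacian_clm_comp (A : F →L[ℝ] G) {f : M → F}
    (hf : ContMDiffAt (𝓡 m) 𝓘(ℝ, F) 2 f x) :
    mapLaplacian g (fun y => A (f y)) x = A (mapLaplacian g f x) :=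
  secondOrderOp_clm_comp A (contDiffAt_inChart hf) _ _

theorem frameDeriv_clm_comp (A : F →L[ℝ] G) {f : M → F}
    (hf : ContMDiffAt (𝓡 m) 𝓘(ℝ, F) 1 f x) (i : Fin m) :
    frameDeriv g (fun y => A (f y)) x i = A (frameDeriv g f x i) :=
  congrArg (fun L : Eucl m →L[ℝ] G => L (frame g x i))
    (A.hasFDerivAt.comp _ ((contDiffAt_inChart hf).differentiableAt one_ne_zero).hasFDerivAt).fderiv

theorem mapLaplacian_smul {f : M → ℝ} {h : M → F} (hf : ContMDiffAt (𝓡 m) 𝓘(ℝ, ℝ) 2 f x)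
    (hh : ContMDiffAt (𝓡 m) 𝓘(ℝ, F) 2 h x) :
    mapLaplacian g (fun y => f y • h y) x = mapLaplacian g f x • h x
      + (2 : ℝ) • ∑ i, frameDeriv g f x i • frameDeriv g h x i + f x • mapLaplacian g h x := by
  have := secondOrderOp_smul (contDiffAt_inChart hf) (contDiffAt_inChart hh) (frame g x)
    (∑ i, christoffel g x (frame g x i) (frame g x i))
  rwa [inChart_center, inChart_center] at this

theorem mapLaplacian_comp {h : F → G} {f : M → F} (hh : ContDiffAt ℝ 2 h (f x))
    (hf : ContMDiffAt (𝓡 m) 𝓘(ℝ, F) 2 f x) :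
    mapLaplacian g (fun y => h (f y)) x =
      ∑ i, fderiv ℝ (fderiv ℝ h) (f x) (frameDeriv g f x i) (frameDeriv g f x i)
        + fderiv ℝ h (f x) (mapLaplacian g f x) := by
  have := secondOrderOp_comp (f := inChart (m := m) x f) (h := h) (x := center x)
    (by simpa using hh) (contDiffAt_inChart hf) (frame g x)
    (∑ i, christoffel g x (frame g x i) (frame g x i))
  rwa [inChart_center] at this

theorem mapLaplacian_comp_of_hasDerivAt {𝕜 : Type*} [NontriviallyNormedField 𝕜]
    [NormedAlgebra ℝ 𝕜] {h h' : 𝕜 → 𝕜} {h'' : 𝕜} {f : M → 𝕜}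
    (hh : ∀ᶠ z in 𝓝 (f x), HasDerivAt h (h' z) z) (hh' : HasDerivAt h' h'' (f x))
    (hf : ContMDiffAt (𝓡 m) 𝓘(ℝ, 𝕜) 2 f x) :
    mapLaplacian g (fun y => h (f y)) x =
      h'' * ∑ i, frameDeriv g f x i ^ 2 + h' (f x) * mapLaplacian g f x := by
  have := secondOrderOp_comp_of_hasDerivAt (f := inChart (m := m) x f) (h := h) (h' := h')
    (x := center x) (by simpa using hh) (by simpa using hh')
    (contDiffAt_inChart hf) (frame g x) (∑ i, christoffel g x (frame g x i) (frame g x i))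
  rwa [inChart_center] at this

section Inner

variable {W : Type*} [NormedAddCommGroup W] [InnerProductSpace ℝ W] {f h : M → W}

theorem mapLaplacian_inner (hf : ContMDiffAt (𝓡 m) 𝓘(ℝ, W) 2 f x)
    (hh : ContMDiffAt (𝓡 m) 𝓘(ℝ, W) 2 h x) :
    mapLaplacian g (fun y => inner ℝ (f y) (h y)) x = inner ℝ (mapLaplacian g f x) (h x)
      + 2 * ∑ i, inner ℝ (frameDeriv g f x i) (frameDeriv g h x i)
      + inner ℝ (f x) (mapLaplacian g h x) := by
  have := secondOrderOp_inner (contDiffAt_inChart hf) (contDiffAt_inChart hh) (frame g x)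
    (∑ i, christoffel g x (frame g x i) (frame g x i))
  rwa [inChart_center, inChart_center] at this

theorem inner_mapLaplacian_add (hf : ContMDiffAt (𝓡 m) 𝓘(ℝ, W) 2 f x)
    (hh : ContMDiffAt (𝓡 m) 𝓘(ℝ, W) 2 h x) {c : ℝ}
    (hc : ∀ᶠ y in 𝓝 x, inner ℝ (f y) (h y) = c) :
    inner ℝ (mapLaplacian g f x) (h x)
      + 2 * ∑ i, inner ℝ (frameDeriv g f x i) (frameDeriv g h x i)
      + inner ℝ (f x) (mapLaplacian g h x) = 0 := by
  rw [← mapLaplacian_inner g hf hh, mapLaplacian_congr g hc, mapLaplacian_const]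

theorem inner_frameDeriv_add (hf : ContMDiffAt (𝓡 m) 𝓘(ℝ, W) 1 f x)
    (hh : ContMDiffAt (𝓡 m) 𝓘(ℝ, W) 1 h x) {c : ℝ}
    (hc : ∀ᶠ y in 𝓝 x, inner ℝ (f y) (h y) = c) (i : Fin m) :
    inner ℝ (f x) (frameDeriv g h x i) + inner ℝ (frameDeriv g f x i) (h x) = 0 := by
  have := inner_fderiv_add_inner_fderiv
    ((contDiffAt_inChart hf).differentiableAt one_ne_zero)
    ((contDiffAt_inChart hh).differentiableAt one_ne_zero)
    (inChart_eventuallyEq (m := m) hc) (frame g x i)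
  rwa [inChart_center, inChart_center] at this

end Inner

theorem frame_orthonormal (x : M) (i j : Fin m) :
    g.inner x (frame g x i) (frame g x j) = if i = j then 1 else 0 :=
  (exists_orthonormalFrame g x).choose_spec i j

theorem linearIndependent_frame (x : M) : LinearIndependent ℝ (frame g x) := by
  refine Fintype.linearIndependent_iff.2 fun a ha i => ?_
  let L : Eucl m →L[ℝ] ℝ := g.inner x (frame g x i)
  have hL : ∀ j, L (frame g x j) = if i = j then 1 else 0 := frame_orthonormal g x i
  simpa [hL] using congrArg L ha

theorem eq_zero_of_apply_frame {A : Eucl m →L[ℝ] F} (h : ∀ i, A (frame g x i) = 0) : A = 0 := by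
  have hspan := (linearIndependent_frame g x).span_eq_top_of_card_eq_finrank' (by simp)
  exact ContinuousLinearMap.coe_injective (LinearMap.ext_on_range hspan h)

end MapLaplacian

/-! ### Maps into the sphere -/

section SphereMaps

variable {m n : ℕ} {M : Type*} [TopologicalSpace M] [ChartedSpace (Eucl m) M] {φ : M → Sph n}

theorem contMDiff_coe {k : WithTop ℕ∞} (hφ : ContMDiff (𝓡 m) (𝓡 n) k φ) :
    ContMDiff (𝓡 m) 𝓘(ℝ, Eucl (n + 1)) k fun z => (φ z : Eucl (n + 1)) := by
  have := finrank_fact n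
  exact (contMDiff_coe_sphere (E := Eucl (n + 1)) (n := n)).comp hφ

theorem contMDiffAt_coe {k : ℕ} (hφ : ContMDiff (𝓡 m) (𝓡 n) ∞ φ) (x : M) :
    ContMDiffAt (𝓡 m) 𝓘(ℝ, Eucl (n + 1)) k (fun z => (φ z : Eucl (n + 1))) x :=
  (contMDiff_coe hφ x).of_le (WithTop.coe_le_coe.2 le_top)

theorem inner_mapDeriv (hφ : ContMDiff (𝓡 m) (𝓡 n) ∞ φ) (x : M) (u : Eucl m) :
    inner ℝ (φ x : Eucl (n + 1)) (mapDeriv φ x u (center x)) = 0 := by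
  have h := inner_fderiv_self_eq_zero
    ((contDiffAt_inChart (contMDiffAt_coe hφ x (k := 1))).differentiableAt one_ne_zero)
    (.of_forall fun y => sphere_inner_self (φ ((extChartAt (𝓡 m) x).symm y))) u
  rwa [inChart_center] at h

theorem inclDeriv_mfderiv {x : M} (hφ : MDifferentiableAt (𝓡 m) (𝓡 n) φ x) (u : Eucl m) :
    inclDeriv n (φ x) (mfderiv (𝓡 m) (𝓡 n) φ x u) = mapDeriv φ x u (center x) := by
  have := finrank_fact n
  have hι : MDifferentiableAt (𝓡 n) 𝓘(ℝ, Eucl (n + 1)) (Subtype.val : Sph n → Eucl (n + 1))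
      (φ x) := (contMDiff_coe_sphere (m := 1) (φ x)).mdifferentiableAt one_ne_zero
  exact ((fderiv_inChart (hι.comp x hφ) u).trans
    (congrArg (fun A : Eucl m →L[ℝ] Eucl (n + 1) => A u) (mfderiv_comp x hι hφ))).symm

variable [IsManifold (𝓡 m) ∞ M] (g : SmoothMetric m M)

/-- The energy density `‖dφ‖²` of a map into the sphere, without the customary factor `1/2`. -/
def energy (g : SmoothMetric m M) (φ : M → Sph n) (x : M) : ℝ :=
  ∑ i, ‖frameDeriv g (fun z => (φ z : Eucl (n + 1))) x i‖ ^ 2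

theorem energy_pos (hn : 1 ≤ n) {x : M} (hφ : MDifferentiableAt (𝓡 m) (𝓡 n) φ x)
    (hsub : Function.Surjective (mfderiv (𝓡 m) (𝓡 n) φ x)) : 0 < energy g φ x := by
  have := finrank_fact n
  refine (Finset.sum_nonneg fun i _ => sq_nonneg _).lt_of_ne' fun h => ?_
  have hframe : ∀ i, frameDeriv g (fun z => (φ z : Eucl (n + 1))) x i = 0 := by
    simpa [Finset.sum_eq_zero_iff_of_nonneg, sq_nonneg, energy] using h
  have hzero : ∀ w : TangentSpace (𝓡 n) (φ x), w = 0 := fun w => by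
    obtain ⟨u, rfl⟩ := hsub w
    refine injective_mvfderiv_subtypeVal_sphere (φ x) ?_
    exact (inclDeriv_mfderiv hφ u).trans <|
      (congrArg (fun A : Eucl m →L[ℝ] Eucl (n + 1) => A u)
        (eq_zero_of_apply_frame g hframe)).trans (map_zero _).symm
  have hsingle : (EuclideanSpace.single (⟨0, hn⟩ : Fin n) (1 : ℝ) : Eucl n) = 0 := hzero _
  simp at hsingle

variable (hφ : ContMDiff (𝓡 m) (𝓡 n) ∞ φ) (x : M)
include hφ

theorem tension_eq : tension g φ x =
    tangentPart (φ x : Eucl (n + 1)) (mapLaplacian g (fun z => (φ z : Eucl (n + 1))) x) := by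
  have htangent : ∀ u, mapDeriv φ x u (center x) =
      tangentProj (φ x : Eucl (n + 1)) (mapDeriv φ x u (center x)) := fun u =>
    (tangentPart_of_inner_eq_zero (inner_mapDeriv hφ x u)).symm
  have hsecond : ∀ i, fderiv ℝ (mapDeriv φ x (frame g x i)) (center x) (frame g x i) =
      fderiv ℝ (fderiv ℝ (inChart x fun z => (φ z : Eucl (n + 1)))) (center x) (frame g x i)
        (frame g x i) := fun i =>
    fderiv_fderiv_apply (contDiffAt_inChart (contMDiffAt_coe hφ x (k := 2))) _ _
  simp only [tension, secondForm, ← tangentProj_apply, hsecond, Finset.sum_sub_distrib]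
  rw [← map_sum, mapLaplacian, secondOrderOp, map_sub, map_sum (fderiv ℝ _ _), map_sum, map_sum]
  exact congrArg _ (Finset.sum_congr rfl fun i _ => htangent _)

theorem inner_mapLaplacian :
    inner ℝ (φ x : Eucl (n + 1)) (mapLaplacian g (fun z => (φ z : Eucl (n + 1))) x) =
      -energy g φ x := by
  have h := inner_mapLaplacian_add g (contMDiffAt_coe hφ x) (contMDiffAt_coe hφ x)
    (.of_forall fun y => sphere_inner_self (φ y))
  simp only [real_inner_self_eq_norm_sq, real_inner_comm (φ x : Eucl (n + 1))] at h
  rw [energy]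
  linarith

omit hφ in
theorem IsHarmonicMap.mapLaplacian_eq (hφ : IsHarmonicMap g φ) :
    mapLaplacian g (fun z => (φ z : Eucl (n + 1))) x = -(energy g φ x • (φ x : Eucl (n + 1))) := by
  have h := hφ.2 x
  rwa [tension_eq g hφ.1, tangentPart, inner_mapLaplacian g hφ.1, sub_eq_zero, neg_smul] at h

end SphereMaps

/-! ### Horizontally conformal maps into the sphere -/

section HorizontallyConformal

open Laplacian

theorem sum_inner_smul_apply {κ E F : Type*} [Fintype κ] [NormedAddCommGroup E]
    [InnerProductSpace ℝ E] [AddCommGroup F] [Module ℝ F] (b : OrthonormalBasis κ ℝ E)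
    (A : E →ₗ[ℝ] F) (v : E) : ∑ j, (inner ℝ v (b j) : ℝ) • A (b j) = A v := by
  conv_rhs => rw [← b.sum_repr' v, map_sum]
  simp only [map_smul, real_inner_comm v]

theorem sum_apply_apply_eq {ι κ E F : Type*} [Fintype ι] [Fintype κ] [NormedAddCommGroup E]
    [InnerProductSpace ℝ E] [AddCommGroup F] [Module ℝ F]
    (b : OrthonormalBasis κ ℝ E) (d : ι → E) (B : E →ₗ[ℝ] E →ₗ[ℝ] F) :
    ∑ i, B (d i) (d i) = ∑ j, B (∑ i, (inner ℝ (d i) (b j) : ℝ) • d i) (b j) := by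
  simp only [map_sum, map_smul, LinearMap.sum_apply, LinearMap.smul_apply]
  rw [Finset.sum_comm]
  exact Finset.sum_congr rfl fun i _ => (sum_inner_smul_apply b (B (d i)) (d i)).symm

variable {m n : ℕ} {M : Type*} [TopologicalSpace M] [ChartedSpace (Eucl m) M]
  [IsManifold (𝓡 m) ∞ M]

/-- `φ` is horizontally conformal at `x` with square dilation `l`, that is,
`dφ ∘ dφ* = l • id` on the tangent space of the sphere at `φ x`. -/
def IsHorizontallyConformalAt (g : SmoothMetric m M) (φ : M → Sph n) (x : M) (l : ℝ) : Prop :=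
  ∀ w, ∑ i, (inner ℝ (frameDeriv g (fun z => (φ z : Eucl (n + 1))) x i) w : ℝ) •
    frameDeriv g (fun z => (φ z : Eucl (n + 1))) x i = l • tangentPart (φ x : Eucl (n + 1)) w

variable {g : SmoothMetric m M} {φ : M → Sph n} {x : M} {l : ℝ}

namespace IsHorizontallyConformalAt

theorem sum_apply_apply {κ F : Type*} [Fintype κ] [AddCommGroup F] [Module ℝ F]
    (h : IsHorizontallyConformalAt g φ x l) (b : OrthonormalBasis κ ℝ (Eucl (n + 1)))
    (B : Eucl (n + 1) →ₗ[ℝ] Eucl (n + 1) →ₗ[ℝ] F) :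
    ∑ i, B (frameDeriv g (fun z => (φ z : Eucl (n + 1))) x i)
        (frameDeriv g (fun z => (φ z : Eucl (n + 1))) x i) =
      l • (∑ j, B (b j) (b j) - B (φ x : Eucl (n + 1)) (φ x : Eucl (n + 1))) := by
  rw [sum_apply_apply_eq b]
  simp only [h _, tangentPart, map_smul, map_sub, LinearMap.smul_apply, LinearMap.sub_apply]
  rw [← Finset.smul_sum, Finset.sum_sub_distrib, sum_inner_smul_apply]

theorem energy_eq (h : IsHorizontallyConformalAt g φ x l) : energy g φ x = n * l := by
  have := h.sum_apply_apply (EuclideanSpace.basisFun _ ℝ) (innerₗ (Eucl (n + 1)))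
  simp only [innerₗ_apply_apply, real_inner_self_eq_norm_sq, OrthonormalBasis.norm_eq_one,
    sphere_norm, smul_eq_mul] at this
  rw [energy, this]
  simp only [one_pow, Finset.sum_const, Finset.card_univ, Fintype.card_fin, nsmul_eq_mul]
  push_cast
  ring

theorem mapLaplacian_comp {F : Type*} [NormedAddCommGroup F] [NormedSpace ℝ F]
    {h : Eucl (n + 1) → F} (hc : IsHorizontallyConformalAt g φ x l)
    (hφ : IsHarmonicMap g φ) (hh : ContDiffAt ℝ 2 h (φ x : Eucl (n + 1))) :
    mapLaplacian g (fun y => h (φ y : Eucl (n + 1))) x =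
      l • (Δ h (φ x : Eucl (n + 1))
        - fderiv ℝ (fderiv ℝ h) (φ x : Eucl (n + 1)) (φ x : Eucl (n + 1)) (φ x : Eucl (n + 1))
        - (n : ℝ) • fderiv ℝ h (φ x : Eucl (n + 1)) (φ x : Eucl (n + 1))) := by
  let b := EuclideanSpace.basisFun (Fin (n + 1)) ℝ
  have hsum := hc.sum_apply_apply b
    (ContinuousLinearMap.coeLM ℝ ∘ₗ (fderiv ℝ (fderiv ℝ h) (φ x : Eucl (n + 1))).toLinearMap)
  simp only [LinearMap.comp_apply, ContinuousLinearMap.coe_coe, ContinuousLinearMap.coeLM_apply]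
    at hsum
  rw [SphereRigidity.mapLaplacian_comp g hh (contMDiffAt_coe hφ.1 x), hsum,
    hφ.mapLaplacian_eq, hc.energy_eq, laplacian_eq_sum b]
  simp only [map_neg, map_smul, smul_sub, smul_smul]
  rw [mul_comm l, ← sub_eq_add_neg]

theorem mapLaplacian_comp_of_isHomogeneous {F : Type*} [NormedAddCommGroup F] [NormedSpace ℝ F]
    {h : Eucl (n + 1) → F} {k : ℤ} (hc : IsHorizontallyConformalAt g φ x l)
    (hφ : IsHarmonicMap g φ) (hk : IsHomogeneous k h) (hh : IsSmoothOffZero h) :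
    mapLaplacian g (fun y => h (φ y : Eucl (n + 1))) x =
      l • (Δ h (φ x : Eucl (n + 1)) - ((k * (k - 1 + n) : ℝ)) • h (φ x : Eucl (n + 1))) := by
  have hp := sphere_ne_zero (φ x)
  rw [hc.mapLaplacian_comp hφ (hh.contDiffAt_two hp), hk.fderiv_fderiv_apply_self hh hp,
    hk.fderiv_apply_self hp (hh.differentiableAt hp)]
  module

end IsHorizontallyConformalAt

end HorizontallyConformal

section RoundSphere

open Filter Topology

variable {n : ℕ}

theorem sum_inner_smul_of_orthonormal {p : Eucl (n + 1)} (hp : ‖p‖ = 1)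
    {τ : Fin n → Eucl (n + 1)} (hτ : ∀ i j, inner ℝ (τ i) (τ j) = if i = j then (1 : ℝ) else 0)
    (hpτ : ∀ i, inner ℝ p (τ i) = (0 : ℝ)) (w : Eucl (n + 1)) :
    ∑ i, (inner ℝ (τ i) w : ℝ) • τ i = tangentPart p w := by
  have ho : Orthonormal ℝ (Fin.cons p τ : Fin (n + 1) → Eucl (n + 1)) := by
    rw [orthonormal_iff_ite]
    intro i j
    cases i using Fin.cases <;> cases j using Fin.cases <;>
      simp [hp, hτ, hpτ, real_inner_comm p, Fin.succ_ne_zero, (Fin.succ_ne_zero _).symm]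
  have hs : ⊤ ≤ Submodule.span ℝ (Set.range (Fin.cons p τ : Fin (n + 1) → Eucl (n + 1))) :=
    (ho.linearIndependent.span_eq_top_of_card_eq_finrank' (by simp)).ge
  have := (OrthonormalBasis.mk ho hs).sum_repr' w
  simp only [OrthonormalBasis.coe_mk, Fin.sum_univ_succ, Fin.cons_zero, Fin.cons_succ] at this
  exact eq_sub_of_add_eq' this

/-- The inclusion of the sphere, read in the preferred chart at `p`. -/
def chartIncl (p : Sph n) : Eucl n → Eucl (n + 1) := inChart p fun q : Sph n => (q : Eucl (n + 1))

theorem inclDeriv_coordField (p : Sph n) {y : Eucl n} (hy : y ∈ (extChartAt (𝓡 n) p).target)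
    (u : Eucl n) :
    inclDeriv n ((extChartAt (𝓡 n) p).symm y) (coordField p u y) = fderiv ℝ (chartIncl p) y u := by
  have := finrank_fact n
  have hchart : MDifferentiableAt 𝓘(ℝ, Eucl n) (𝓡 n) (extChartAt (𝓡 n) p).symm y :=
    ((contMDiffOn_extChartAt_symm (n := 1) p).contMDiffAt
      ((isOpen_extChartAt_target p).mem_nhds hy)).mdifferentiableAt one_ne_zero
  have hincl : MDifferentiableAt (𝓡 n) 𝓘(ℝ, Eucl (n + 1)) (Subtype.val : Sph n → Eucl (n + 1))
      ((extChartAt (𝓡 n) p).symm y) :=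
    (contMDiff_coe_sphere (m := 1) _).mdifferentiableAt one_ne_zero
  have hcomp : mfderiv 𝓘(ℝ, Eucl n) 𝓘(ℝ, Eucl (n + 1))
      ((Subtype.val : Sph n → Eucl (n + 1)) ∘ (extChartAt (𝓡 n) p).symm) y =
      fderiv ℝ (chartIncl p) y := mfderiv_eq_fderiv
  exact (congrArg (fun A : Eucl n →L[ℝ] Eucl (n + 1) => A u)
    (hcomp.symm.trans (mfderiv_comp y hincl hchart))).symm

theorem metricCoeff_roundMetric (p : Sph n) (u v : Eucl n) :
    metricCoeff (roundMetric n) p u v =ᶠ[𝓝 (center p)] fun y =>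
      inner ℝ (fderiv ℝ (chartIncl p) y u) (fderiv ℝ (chartIncl p) y v) := by
  filter_upwards [extChartAt_target_mem_nhds (I := 𝓡 n) p] with y hy
  rw [← inclDeriv_coordField p hy, ← inclDeriv_coordField p hy]
  rfl

theorem contDiffAt_chartIncl (p : Sph n) : ContDiffAt ℝ 2 (chartIncl p) (center p) :=
  contDiffAt_inChart (contMDiffAt_coe contMDiff_id p)

theorem fderiv_metricCoeff_roundMetric (p : Sph n) (u v w : Eucl n) :
    fderiv ℝ (metricCoeff (roundMetric n) p v w) (center p) u =
      inner ℝ (fderiv ℝ (chartIncl p) (center p) v)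
          (fderiv ℝ (fderiv ℝ (chartIncl p)) (center p) u w)
        + inner ℝ (fderiv ℝ (fderiv ℝ (chartIncl p)) (center p) u v)
          (fderiv ℝ (chartIncl p) (center p) w) := by
  have hd := contDiffAt_chartIncl p
  have hdiff : ∀ v, DifferentiableAt ℝ (fun y => fderiv ℝ (chartIncl p) y v) (center p) :=
    fun v => (differentiableAt_fderiv hd).clm_apply (differentiableAt_const v)
  rw [(metricCoeff_roundMetric p v w).fderiv_eq, fderiv_inner_apply ℝ (hdiff v) (hdiff w),
    fderiv_fderiv_apply hd, fderiv_fderiv_apply hd]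

theorem christoffelLower_roundMetric (p : Sph n) (u v w : Eucl n) :
    christoffelLower (roundMetric n) p u v w =
      inner ℝ (fderiv ℝ (fderiv ℝ (chartIncl p)) (center p) u v)
        (fderiv ℝ (chartIncl p) (center p) w) := by
  have hsymm := (contDiffAt_chartIncl p).isSymmSndFDerivAt (by simp)
  rw [christoffelLower, fderiv_metricCoeff_roundMetric, fderiv_metricCoeff_roundMetric,
    fderiv_metricCoeff_roundMetric, hsymm.eq v u, hsymm.eq w u, hsymm.eq w v,
    real_inner_comm (fderiv ℝ (fderiv ℝ (chartIncl p)) (center p) u w)]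
  ring

theorem isHorizontallyConformalAt_id (p : Sph n) :
    IsHorizontallyConformalAt (roundMetric n) (fun q : Sph n => q) p 1 := by
  intro w
  rw [one_smul]
  refine sum_inner_smul_of_orthonormal (sphere_norm p) (fun i j => ?_)
    (fun i => inner_mapDeriv contMDiff_id p _) w
  have hd : ∀ u, fderiv ℝ (chartIncl p) (center p) u = inclDeriv n p u :=
    fderiv_inChart ((contMDiff_coe (k := 1) contMDiff_id).mdifferentiable one_ne_zero p)
  rw [← frame_orthonormal (roundMetric n) p i j]
  exact congrArg₂ (inner ℝ) (hd (frame (roundMetric n) p i)) (hd (frame (roundMetric n) p j))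

theorem fderiv_chartIncl_christoffel (p : Sph n) (u v : Eucl n) :
    fderiv ℝ (chartIncl p) (center p) (christoffel (roundMetric n) p u v) =
      tangentPart (p : Eucl (n + 1)) (fderiv ℝ (fderiv ℝ (chartIncl p)) (center p) u v) := by
  have h := isHorizontallyConformalAt_id p (fderiv ℝ (fderiv ℝ (chartIncl p)) (center p) u v)
  rw [one_smul] at h
  simp only [christoffel, map_sum, map_smul, christoffelLower_roundMetric]
  rw [← h]
  exact Finset.sum_congr rfl fun i _ => by rw [real_inner_comm]; rfl

theorem isHarmonicMap_id : IsHarmonicMap (roundMetric n) (fun q : Sph n => q) := by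
  refine ⟨contMDiff_id, fun p => ?_⟩
  have hnormal : mapLaplacian (roundMetric n) (fun q : Sph n => (q : Eucl (n + 1))) p =
      ∑ i, (inner ℝ (p : Eucl (n + 1)) (fderiv ℝ (fderiv ℝ (chartIncl p)) (center p)
        (frame (roundMetric n) p i) (frame (roundMetric n) p i)) : ℝ) • (p : Eucl (n + 1)) := by
    rw [mapLaplacian, secondOrderOp, map_sum, ← Finset.sum_sub_distrib]
    refine Finset.sum_congr rfl fun i _ => ?_
    exact (congrArg _ (fderiv_chartIncl_christoffel p _ _)).trans (sub_sub_cancel _ _)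
  rw [tension_eq (φ := fun q : Sph n => q) _ contMDiff_id, hnormal, ← Finset.sum_smul,
    ← tangentProj_apply, map_smul, tangentProj_apply,
    tangentPart_self (sphere_inner_self p), smul_zero]

end RoundSphere

/-! ### Harmonic morphisms into the sphere -/

section HarmonicMorphism

open Filter Topology

/-- The complex-valued form `⟨u, ·⟩ + i ⟨v, ·⟩`. -/
def complexForm {E : Type*} [NormedAddCommGroup E] [InnerProductSpace ℝ E] (u v : E) : E →L[ℝ] ℂ :=
  Complex.ofRealCLM ∘L innerSL ℝ u + Complex.I • (Complex.ofRealCLM ∘L innerSL ℝ v)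

theorem complexForm_apply {E : Type*} [NormedAddCommGroup E] [InnerProductSpace ℝ E] (u v w : E) :
    complexForm u v w = (inner ℝ u w : ℝ) + Complex.I * (inner ℝ v w : ℝ) := rfl

theorem sum_complexForm_sq {ι E : Type*} [Fintype ι] [NormedAddCommGroup E] [InnerProductSpace ℝ E]
    (b : OrthonormalBasis ι ℝ E) {u v : E} (hnorm : ‖u‖ = ‖v‖) (huv : inner ℝ u v = (0 : ℝ)) :
    ∑ j, complexForm u v (b j) ^ 2 = 0 := by
  have hsum : ∀ a c : E, ∑ j, (inner ℝ a (b j) : ℂ) * (inner ℝ c (b j) : ℝ) = (inner ℝ a c : ℝ) :=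
    fun a c => by
      rw [← b.sum_inner_mul_inner a c]
      push_cast
      exact Finset.sum_congr rfl fun j _ => by rw [real_inner_comm c]
  have hexpand : ∀ j, complexForm u v (b j) ^ 2 = (inner ℝ u (b j) : ℂ) * (inner ℝ u (b j) : ℝ)
      - (inner ℝ v (b j) : ℂ) * (inner ℝ v (b j) : ℝ)
      + 2 * Complex.I * ((inner ℝ u (b j) : ℂ) * (inner ℝ v (b j) : ℝ)) := fun j => by
    rw [complexForm_apply]
    linear_combination (inner ℝ v (b j) : ℂ) ^ 2 * Complex.I_sq
  simp only [hexpand, Finset.sum_add_distrib, Finset.sum_sub_distrib, ← Finset.mul_sum, hsum,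
    real_inner_self_eq_norm_sq, hnorm, huv]
  simp

theorem exists_hasDerivAt_inv_pow (n : ℕ) :
    ∃ F : ℂ → ℂ, ∀ z ∈ Complex.slitPlane, HasDerivAt F (z ^ n)⁻¹ z := by
  rcases eq_or_ne n 1 with rfl | hn
  · exact ⟨Complex.log, fun z hz => by simpa using Complex.hasDerivAt_log hz⟩
  · have hn' : (1 - n : ℂ) ≠ 0 := sub_ne_zero.2 fun h => hn (by exact_mod_cast h.symm)
    refine ⟨fun z => z ^ (1 - n : ℤ) / (1 - n), fun z hz => ?_⟩
    refine ((hasDerivAt_zpow (1 - n : ℤ) z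
      (.inl (Complex.slitPlane_ne_zero hz))).div_const (1 - n : ℂ)).congr_deriv ?_
    push_cast
    rw [mul_div_cancel_left₀ _ hn', sub_sub_cancel_left, zpow_neg, zpow_natCast]

theorem hasDerivAt_inv_pow (n : ℕ) {z : ℂ} (hz : z ≠ 0) :
    HasDerivAt (fun z : ℂ => (z ^ n)⁻¹) (-(n * (z ^ n)⁻¹ / z)) z := by
  have := hasDerivAt_zpow (-n : ℤ) z (.inl hz)
  simp only [zpow_neg, zpow_natCast, zpow_sub_one₀ hz, Int.cast_neg, Int.cast_natCast] at this
  exact this.congr_deriv (by ring)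

/-- A primitive of `z ↦ z⁻ⁿ` on the slit plane. Its composition with an isotropic complex linear
form restricts to a harmonic function on an open half of `S^n`. -/
def invPowPrimitive (n : ℕ) : ℂ → ℂ := (exists_hasDerivAt_inv_pow n).choose

theorem hasDerivAt_invPowPrimitive (n : ℕ) {z : ℂ} (hz : z ∈ Complex.slitPlane) :
    HasDerivAt (invPowPrimitive n) (z ^ n)⁻¹ z :=
  (exists_hasDerivAt_inv_pow n).choose_spec z hz

theorem contDiffAt_invPowPrimitive (n : ℕ) {z : ℂ} (hz : z ∈ Complex.slitPlane) {k : WithTop ℕ∞} :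
    ContDiffAt ℝ k (invPowPrimitive n) z :=
  ((DifferentiableOn.contDiffOn (fun _ hw => (hasDerivAt_invPowPrimitive n
    hw).differentiableAt.differentiableWithinAt) Complex.isOpen_slitPlane).contDiffAt
    (Complex.isOpen_slitPlane.mem_nhds hz)).restrict_scalars ℝ

theorem IsHarmonicMorphism.mapLaplacian_comp {m n : ℕ} {M N F : Type*}
    [TopologicalSpace M] [ChartedSpace (Eucl m) M] [IsManifold (𝓡 m) ∞ M]
    [TopologicalSpace N] [ChartedSpace (Eucl n) N] [IsManifold (𝓡 n) ∞ N]
    [NormedAddCommGroup F] [NormedSpace ℝ F]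
    {g : SmoothMetric m M} {h : SmoothMetric n N} {φ : M → N} (hφ : IsHarmonicMorphism g h φ)
    {U : Set N} (hU : IsOpen U) {f : N → F} (hf : ContMDiffOn (𝓡 n) 𝓘(ℝ, F) ∞ f U)
    (hΔ : ∀ p ∈ U, mapLaplacian h f p = 0) {x : M} (hx : φ x ∈ U) :
    mapLaplacian g (fun y => f (φ y)) x = 0 := by
  have htwo : (2 : WithTop ℕ∞) ≤ ∞ := WithTop.coe_le_coe.2 le_top
  have hf' : ∀ p ∈ U, ContMDiffAt (𝓡 n) 𝓘(ℝ, F) ∞ f p := fun p hp =>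
    (hf p hp).contMDiffAt (hU.mem_nhds hp)
  refine SeparatingDual.eq_zero_of_forall_dual_eq_zero (R := ℝ) fun A => ?_
  have hA : IsHarmonicFunctionOn h (fun p => A (f p)) U := by
    refine ⟨A.contMDiff.comp_contMDiffOn hf, fun p hp => ?_⟩
    have hAf : ContMDiffAt (𝓡 n) 𝓘(ℝ, ℝ) 2 (fun p => A (f p)) p :=
      (A.contDiff.comp_contMDiffAt (hf' p hp)).of_le htwo
    rw [laplacian_eq_mapLaplacian h hAf, mapLaplacian_clm_comp h A ((hf' p hp).of_le htwo),
      hΔ p hp, map_zero]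
  have hfφ : ContMDiffAt (𝓡 m) 𝓘(ℝ, F) 2 (fun y => f (φ y)) x :=
    ((hf' _ hx).comp x (hφ.1 x)).of_le htwo
  have hAfφ : ContMDiffAt (𝓡 m) 𝓘(ℝ, ℝ) 2 (fun y => A (f (φ y))) x :=
    A.contDiff.comp_contMDiffAt hfφ
  rw [← mapLaplacian_clm_comp g A hfφ, ← laplacian_eq_mapLaplacian g hAfφ]
  exact (hφ.2 U _ hU hA).2 x hx

variable {m n : ℕ} {M : Type*} [TopologicalSpace M] [ChartedSpace (Eucl m) M]
  [IsManifold (𝓡 m) ∞ M] {φ : M → Sph n} {x : M}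

theorem mapLaplacian_invPowPrimitive_comp (g : SmoothMetric m M)
    (hφ : ContMDiff (𝓡 m) (𝓡 n) ∞ φ) (L : Eucl (n + 1) →L[ℝ] ℂ)
    (hx : L (φ x : Eucl (n + 1)) ∈ Complex.slitPlane) :
    mapLaplacian g (fun y => invPowPrimitive n (L (φ y : Eucl (n + 1)))) x =
      (L (φ x : Eucl (n + 1)) ^ n)⁻¹ *
        (L (mapLaplacian g (fun y => (φ y : Eucl (n + 1))) x)
          - n / L (φ x : Eucl (n + 1)) *
            ∑ i, L (frameDeriv g (fun y => (φ y : Eucl (n + 1))) x i) ^ 2) := by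
  have hφx := contMDiffAt_coe (k := 2) hφ x
  rw [mapLaplacian_comp_of_hasDerivAt g (f := fun y => L (φ y : Eucl (n + 1)))
      (eventually_of_mem (Complex.isOpen_slitPlane.mem_nhds hx)
        fun z => hasDerivAt_invPowPrimitive n)
      (hasDerivAt_inv_pow n (Complex.slitPlane_ne_zero hx))
      (L.contDiff.comp_contMDiffAt hφx), mapLaplacian_clm_comp g L hφx]
  simp only [frameDeriv_clm_comp g L (contMDiffAt_coe (k := 1) hφ x)]
  ring

theorem mapLaplacian_invPowPrimitive_sphere {u v : Eucl (n + 1)} (hnorm : ‖u‖ = ‖v‖)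
    (huv : inner ℝ u v = (0 : ℝ)) {p : Sph n}
    (hp : complexForm u v (p : Eucl (n + 1)) ∈ Complex.slitPlane) :
    mapLaplacian (roundMetric n)
      (fun q : Sph n => invPowPrimitive n (complexForm u v (q : Eucl (n + 1)))) p = 0 := by
  let L := complexForm u v
  have hsum := (isHorizontallyConformalAt_id p).sum_apply_apply
    (EuclideanSpace.basisFun (Fin (n + 1)) ℝ) ((LinearMap.mul ℝ ℂ).compl₁₂ L.toLinearMap L)
  simp only [LinearMap.compl₁₂_apply, LinearMap.mul_apply', ContinuousLinearMap.coe_coe, ← sq, L,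
    sum_complexForm_sq _ hnorm huv, one_smul, zero_sub] at hsum
  have hmul := mul_inv_cancel₀ (Complex.slitPlane_ne_zero hp)
  rw [mapLaplacian_invPowPrimitive_comp (φ := fun q : Sph n => q) _ contMDiff_id _ hp, hsum,
    isHarmonicMap_id.mapLaplacian_eq, (isHorizontallyConformalAt_id p).energy_eq]
  simp only [map_neg, map_smul, Complex.real_smul, mul_one, Complex.ofReal_natCast]
  linear_combination ((complexForm u v (p : Eucl (n + 1)) ^ n)⁻¹ * n *
    complexForm u v (p : Eucl (n + 1))) * hmul

theorem inner_self_tangentPart {p : Eucl (n + 1)} (hp : inner ℝ p p = 1) (w : Eucl (n + 1)) :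
    inner ℝ p (tangentPart p w) = 0 := by
  rw [tangentPart, inner_sub_right, real_inner_smul_right, hp, mul_one, sub_self]

namespace IsHarmonicMorphism

variable {g : SmoothMetric m M}

theorem complexForm_mapLaplacian (hφ : IsHarmonicMorphism g (roundMetric n) φ)
    {u v : Eucl (n + 1)} (hnorm : ‖u‖ = ‖v‖) (huv : inner ℝ u v = (0 : ℝ))
    (hx : complexForm u v (φ x : Eucl (n + 1)) ∈ Complex.slitPlane) :
    complexForm u v (φ x : Eucl (n + 1)) *
        complexForm u v (mapLaplacian g (fun y => (φ y : Eucl (n + 1))) x) =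
      n * ∑ i, complexForm u v (frameDeriv g (fun y => (φ y : Eucl (n + 1))) x i) ^ 2 := by
  let U : Set (Sph n) := {p | complexForm u v (p : Eucl (n + 1)) ∈ Complex.slitPlane}
  have hU : IsOpen U := Complex.isOpen_slitPlane.preimage
    ((complexForm u v).continuous.comp continuous_subtype_val)
  have hsmooth : ContMDiffOn (𝓡 n) 𝓘(ℝ, ℂ) ∞
      (fun q : Sph n => invPowPrimitive n (complexForm u v (q : Eucl (n + 1)))) U := fun p hp =>
    ((contDiffAt_invPowPrimitive n hp).comp_contMDiffAt (f := fun q : Sph n =>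
      complexForm u v (q : Eucl (n + 1))) ((complexForm u v).contDiff.comp_contMDiff
      (contMDiff_coe contMDiff_id) p)).contMDiffWithinAt
  have hzero := hφ.mapLaplacian_comp hU hsmooth
    (fun p hp => mapLaplacian_invPowPrimitive_sphere hnorm huv hp) hx
  have hne := Complex.slitPlane_ne_zero hx
  rw [mapLaplacian_invPowPrimitive_comp g hφ.1 _ hx, mul_eq_zero_iff_left (by simp [hne]),
    sub_eq_zero] at hzero
  rw [hzero]
  field_simp

theorem inner_mapLaplacian_eq_zero_and (hφ : IsHarmonicMorphism g (roundMetric n) φ)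
    {v : Eucl (n + 1)} (hv : inner ℝ (φ x : Eucl (n + 1)) v = 0) :
    inner ℝ v (mapLaplacian g (fun y => (φ y : Eucl (n + 1))) x) = 0 ∧
      n * ∑ i, inner ℝ v (frameDeriv g (fun y => (φ y : Eucl (n + 1))) x i) ^ 2 =
        ‖v‖ ^ 2 * energy g φ x := by
  rcases eq_or_ne v 0 with rfl | hv0
  · simp
  have hd : ∀ i, inner ℝ (φ x : Eucl (n + 1))
      (frameDeriv g (fun y => (φ y : Eucl (n + 1))) x i) = 0 := fun i => inner_mapDeriv hφ.1 x _
  have hLφ : complexForm (‖v‖ • (φ x : Eucl (n + 1))) v (φ x : Eucl (n + 1)) = ‖v‖ := by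
    simp [complexForm_apply, real_inner_smul_left, real_inner_comm (φ x : Eucl (n + 1)) v, hv]
  have h := hφ.complexForm_mapLaplacian (x := x) (u := ‖v‖ • (φ x : Eucl (n + 1))) (v := v)
    (by simp [norm_smul]) (by simp [real_inner_smul_left, hv])
    (by rw [hLφ, Complex.ofReal_mem_slitPlane]; exact norm_pos_iff.2 hv0)
  rw [hLφ] at h
  simp only [complexForm_apply, real_inner_smul_left, hd, inner_mapLaplacian g hφ.1, mul_zero,
    Complex.ofReal_zero, zero_add, mul_pow, Complex.I_sq] at h
  have hre := congrArg Complex.re h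
  have him := congrArg Complex.im h
  simp only [mul_neg, Complex.ofReal_neg, Complex.mul_re, Complex.ofReal_re, Complex.add_re,
    Complex.neg_re, Complex.I_re, zero_mul, Complex.I_im, Complex.ofReal_im, mul_zero, sub_self,
    add_zero, Complex.add_im, Complex.neg_im, neg_zero, Complex.mul_im, one_mul, zero_add, sub_zero,
    ← Complex.ofReal_pow, neg_mul, Finset.sum_neg_distrib, Complex.natCast_re, Complex.re_sum,
    Complex.natCast_im, Complex.im_sum, Finset.sum_const_zero, neg_inj, mul_eq_zero, norm_eq_zero,
    hv0, false_or] at hre him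
  exact ⟨him, by rw [← hre]; ring⟩

theorem isHarmonicMap (hφ : IsHarmonicMorphism g (roundMetric n) φ) : IsHarmonicMap g φ := by
  refine ⟨hφ.1, fun x => ?_⟩
  have htangent := inner_self_tangentPart (p := (φ x : Eucl (n + 1))) (sphere_inner_self _)
    (mapLaplacian g (fun y => (φ y : Eucl (n + 1))) x)
  rw [tension_eq g hφ.1, ← inner_self_eq_zero (𝕜 := ℝ), inner_tangentPart htangent,
    real_inner_comm]
  exact (hφ.inner_mapLaplacian_eq_zero_and htangent).1

theorem isHorizontallyConformalAt (hn : 1 ≤ n) (hφ : IsHarmonicMorphism g (roundMetric n) φ)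
    (x : M) : IsHorizontallyConformalAt g φ x (energy g φ x / n) := by
  let d : Fin m → Eucl (n + 1) := frameDeriv g (fun y => (φ y : Eucl (n + 1))) x
  let T : Eucl (n + 1) →ₗ[ℝ] Eucl (n + 1) := ∑ i, (innerₗ (Eucl (n + 1)) (d i)).smulRight (d i)
    - (energy g φ x / n) • (tangentProj (φ x : Eucl (n + 1))).toLinearMap
  have hT : ∀ w, T w = ∑ i, (inner ℝ (d i) w : ℝ) • d i
      - (energy g φ x / n) • tangentPart (φ x : Eucl (n + 1)) w := fun w => by
    simp [T, tangentProj_apply]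
  have hsymm : T.IsSymmetric := fun a b => by
    simp only [hT, inner_sub_left, inner_sub_right, sum_inner, inner_sum, tangentPart,
      real_inner_smul_left, real_inner_smul_right, real_inner_comm (d _),
      real_inner_comm (φ x : Eucl (n + 1)), mul_comm (inner ℝ (d _) a)]
    ring
  have hT0 : T = 0 := hsymm.inner_map_self_eq_zero.1 fun w => by
    let P : Eucl (n + 1) := φ x
    have hPd : ∀ i, inner ℝ P (d i) = 0 := fun i => inner_mapDeriv hφ.1 x _
    have htangent := inner_self_tangentPart (sphere_inner_self (φ x)) w
    have hsum := (hφ.inner_mapLaplacian_eq_zero_and htangent).2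
    have hn0 : (n : ℝ) ≠ 0 := Nat.cast_ne_zero.2 (Nat.one_le_iff_ne_zero.1 hn)
    have hnorm : inner ℝ (tangentPart P w) w = ‖tangentPart P w‖ ^ 2 := by
      rw [← real_inner_self_eq_norm_sq, real_inner_comm, inner_tangentPart htangent,
        real_inner_comm]
    have hsum' : n * ∑ i, (inner ℝ (d i) w : ℝ) ^ 2 = ‖tangentPart P w‖ ^ 2 * energy g φ x := by
      rw [← hsum]
      simp only [inner_tangentPart (hPd _), real_inner_comm w, P, d]
    rw [hT, inner_sub_left, sum_inner, real_inner_smul_left, hnorm]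
    simp only [real_inner_smul_left, ← sq]
    field_simp
    linear_combination hsum'
  exact fun w => sub_eq_zero.1 ((hT w).symm.trans (DFunLike.congr_fun hT0 w))

end IsHarmonicMorphism

end HarmonicMorphism

/-! ### Descent along surjective submersions -/

section Descent

open Filter Topology

theorem exists_contDiffAt_rightInverse {E F : Type*} [NormedAddCommGroup E] [NormedSpace ℝ E]
    [NormedAddCommGroup F] [NormedSpace ℝ F] [FiniteDimensional ℝ F] {k : WithTop ℕ∞} {f : E → F}
    {a : E} (hf : ContDiffAt ℝ k f a) (hk : k ≠ 0) (hsurj : Function.Surjective (fderiv ℝ f a)) :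
    ∃ s : F → E, ContDiffAt ℝ k s (f a) ∧ s (f a) = a ∧ ∀ᶠ q in 𝓝 (f a), f (s q) = q := by
  have := FiniteDimensional.complete ℝ F
  obtain ⟨B, hB⟩ := (fderiv ℝ f a).exists_rightInverse_of_surjective
    (LinearMap.range_eq_top.2 hsurj)
  have hpath : HasFDerivAt (fun w => a + B w) B 0 := B.hasFDerivAt.const_add a
  have hf' : ContDiffAt ℝ k f (a + B 0) := by simpa using hf
  have hΨ : ContDiffAt ℝ k (fun w => f (a + B w)) 0 :=
    hf'.comp 0 (contDiffAt_const.add B.contDiff.contDiffAt)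
  have hΨ' : HasFDerivAt (fun w => f (a + B w))
      ((ContinuousLinearEquiv.refl ℝ F : F ≃L[ℝ] F) : F →L[ℝ] F) 0 := by
    have h := (hf'.differentiableAt hk).hasFDerivAt.comp 0 hpath
    rw [map_zero, add_zero, hB] at h
    exact h
  have hstrict := hΨ.hasStrictFDerivAt' hΨ' hk
  have h0 : f (a + B 0) = f a := by rw [map_zero, add_zero]
  have hinv := hΨ.to_localInverse hΨ' hk
  have hinv0 := hstrict.localInverse_apply_image
  have hright := hstrict.eventually_right_inverse
  simp only [h0] at hinv hinv0 hright
  refine ⟨fun q => a + B (hΨ.localInverse hΨ' hk q),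
    contDiffAt_const.add (B.contDiff.contDiffAt.comp _ hinv), ?_, hright⟩
  have : hΨ.localInverse hΨ' hk (f a) = 0 := hinv0
  simp only [this, map_zero, add_zero]

variable {n : ℕ} {M F : Type*} [NormedAddCommGroup F] {φ : M → Sph n} {V : M → F}

theorem exists_eq_smul_map (hsurj : Function.Surjective φ) {q : Eucl (n + 1)} (hq : q ≠ 0) :
    ∃ x, q = ‖q‖ • (φ x : Eucl (n + 1)) := by
  have hq' := norm_ne_zero_iff.2 hq
  obtain ⟨x, hx⟩ := hsurj ⟨‖q‖⁻¹ • q, by simp [norm_smul, hq']⟩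
  exact ⟨x, by rw [hx, smul_inv_smul₀ hq']⟩

/-- The function on Euclidean space, constant along rays from the origin, whose pull-back by `φ`
is the function `V` constant on the fibres of `φ`. Its value off the cone over the image of `φ`,
in particular at the origin, is `0`. -/
def radialDescent (φ : M → Sph n) (V : M → F) (q : Eucl (n + 1)) : F :=
  Function.extend (fun x => (φ x : Eucl (n + 1))) V 0 (‖q‖⁻¹ • q)

theorem radialDescent_smul {r : ℝ} (hr : 0 < r) (q : Eucl (n + 1)) :
    radialDescent φ V (r • q) = radialDescent φ V q := by
  rw [radialDescent, radialDescent, norm_smul, Real.norm_of_nonneg hr.le, smul_smul, mul_inv,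
    mul_right_comm, inv_mul_cancel₀ hr.ne', one_mul]

theorem radialDescent_map (hV : V.FactorsThrough φ) (x : M) :
    radialDescent φ V (φ x) = V x := by
  rw [radialDescent, sphere_norm, inv_one, one_smul]
  exact Function.FactorsThrough.extend_apply (fun _ _ h => hV (Subtype.ext h)) _ x

variable [NormedSpace ℝ F] in
theorem isHomogeneous_radialDescent : IsHomogeneous 0 (radialDescent φ V) :=
  fun q _ r hr => by rw [radialDescent_smul hr, zpow_zero, one_smul]

variable {m : ℕ} [TopologicalSpace M] [ChartedSpace (Eucl m) M]

theorem exists_mapDeriv_eq {x : M} (hφ : MDifferentiableAt (𝓡 m) (𝓡 n) φ x)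
    (hsub : Function.Surjective (mfderiv (𝓡 m) (𝓡 n) φ x)) {w : Eucl (n + 1)}
    (hw : inner ℝ (φ x : Eucl (n + 1)) w = 0) : ∃ u, mapDeriv φ x u (center x : Eucl m) = w := by
  have := finrank_fact n
  have hmem : w ∈ (mvfderiv (𝓡 n) (Subtype.val : Sph n → Eucl (n + 1)) (φ x)).range := by
    rw [range_mvfderiv_subtypeVal]
    exact Submodule.mem_orthogonal_singleton_iff_inner_right.2 hw
  obtain ⟨v, rfl⟩ := hmem
  obtain ⟨u, rfl⟩ := hsub v
  exact ⟨u, (inclDeriv_mfderiv hφ u).symm⟩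

/-- The cone `(r, y) ↦ r • φ y` over a map into the sphere, with `y` read in the preferred chart
at `x`. It is a submersion where `φ` is one, and its local sections are used to show that smooth
functions descend along `φ` to smooth functions on punctured Euclidean space. -/
def coneMap (φ : M → Sph n) (x : M) (z : ℝ × Eucl m) : Eucl (n + 1) :=
  z.1 • inChart x (fun y => (φ y : Eucl (n + 1))) z.2

theorem coneMap_center (x : M) (r : ℝ) :
    coneMap φ x (r, (center x : Eucl m)) = r • (φ x : Eucl (n + 1)) := by
  rw [coneMap, inChart_center]

theorem radialDescent_coneMap (hV : V.FactorsThrough φ) (x : M) {z : ℝ × Eucl m} (hz : 0 < z.1) :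
    radialDescent φ V (coneMap φ x z) = inChart x V z.2 :=
  (radialDescent_smul hz _).trans (radialDescent_map hV _)

theorem contDiffAt_coneMap (hφ : ContMDiff (𝓡 m) (𝓡 n) ∞ φ) (x : M) (r : ℝ) :
    ContDiffAt ℝ ∞ (coneMap φ x) (r, (center x : Eucl m)) :=
  contDiffAt_fst.smul <| ContDiffAt.comp
    (g := inChart x fun y => (φ y : Eucl (n + 1))) (f := Prod.snd) (r, center x)
    (contDiffAt_inChart (contMDiff_coe hφ x)) contDiffAt_snd

theorem surjective_fderiv_coneMap (hφ : ContMDiff (𝓡 m) (𝓡 n) ∞ φ) {x : M}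
    (hsub : Function.Surjective (mfderiv (𝓡 m) (𝓡 n) φ x)) {r : ℝ} (hr : r ≠ 0) :
    Function.Surjective (fderiv ℝ (coneMap φ x) (r, (center x : Eucl m))) := by
  intro w
  let Φ : Eucl m → Eucl (n + 1) := inChart x fun y => (φ y : Eucl (n + 1))
  obtain ⟨u, hu⟩ : ∃ u, fderiv ℝ Φ (center x) u = tangentPart (φ x : Eucl (n + 1)) w :=
    exists_mapDeriv_eq (hφ.mdifferentiable (by simp) x) hsub
      (inner_self_tangentPart (sphere_inner_self _) w)
  have hΦx : Φ (center x) = φ x := inChart_center x _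
  have hΦ : DifferentiableAt ℝ Φ (center x) :=
    (contDiffAt_inChart (contMDiffAt_coe hφ x (k := 1))).differentiableAt one_ne_zero
  have hderiv : HasFDerivAt (coneMap φ x) _ (r, center x) :=
    hasFDerivAt_fst.fun_smul <| HasFDerivAt.comp (g := Φ) (f := Prod.snd) (r, center x)
      hΦ.hasFDerivAt hasFDerivAt_snd
  refine ⟨(inner ℝ (φ x : Eucl (n + 1)) w, r⁻¹ • u), ?_⟩
  rw [hderiv.fderiv]
  change r • fderiv ℝ Φ (center x) (r⁻¹ • u) +
    (inner ℝ (φ x : Eucl (n + 1)) w : ℝ) • Φ (center x) = w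
  rw [map_smul, smul_inv_smul₀ hr, hu, hΦx, tangentPart, sub_add_cancel]

variable [NormedSpace ℝ F] in
theorem isSmoothOffZero_radialDescent (hφ : ContMDiff (𝓡 m) (𝓡 n) ∞ φ)
    (hsurj : Function.Surjective φ) (hsub : ∀ x, Function.Surjective (mfderiv (𝓡 m) (𝓡 n) φ x))
    (hV : ContMDiff (𝓡 m) 𝓘(ℝ, F) ∞ V) (hfac : V.FactorsThrough φ) :
    IsSmoothOffZero (radialDescent φ V) := by
  intro q hq
  obtain ⟨x, hx⟩ := exists_eq_smul_map hsurj hq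
  have hpos := norm_pos_iff.2 hq
  obtain ⟨s, hs, hsq, hsection⟩ := exists_contDiffAt_rightInverse
    (contDiffAt_coneMap hφ x ‖q‖) (by simp) (surjective_fderiv_coneMap hφ (hsub x) hpos.ne')
  rw [coneMap_center, ← hx] at hs hsq hsection
  have hsmooth : ContDiffAt ℝ ∞ (fun q' => inChart x V (s q').2) q :=
    ContDiffAt.comp (g := inChart x V) (f := fun q' => (s q').2) q
      (by rw [hsq]; exact contDiffAt_inChart (hV x)) (contDiffAt_snd.comp q hs)
  have hspos : ∀ᶠ q' in 𝓝 q, 0 < (s q').1 :=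
    hs.continuousAt.fst.eventually_const_lt (by simpa only [hsq] using hpos)
  refine hsmooth.congr_of_eventuallyEq ?_
  filter_upwards [hsection, hspos] with q' hq' hq'pos
  rw [← radialDescent_coneMap hfac x hq'pos, hq']

end Descent

/-! ### Projectable eigenmaps -/

section Eigenmaps

open Laplacian

variable {m n : ℕ} {M : Type*} [TopologicalSpace M] [ChartedSpace (Eucl m) M]
  [IsManifold (𝓡 m) ∞ M] {g : SmoothMetric m M} {φ : M → Sph n}
  (hn : 1 ≤ n) (hφ : IsHarmonicMap g φ)
  (hconf : ∀ x, IsHorizontallyConformalAt g φ x (energy g φ x / n))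
  (hsurj : Function.Surjective φ) (hsub : ∀ x, Function.Surjective (mfderiv (𝓡 m) (𝓡 n) φ x))
include hn hφ hsub

theorem IsHarmonicMap.dilation_pos (x : M) : 0 < energy g φ x / n :=
  div_pos (energy_pos g hn (hφ.1.mdifferentiable (by simp) x) (hsub x)) (Nat.cast_pos.2 hn)

include hconf hsurj

/-- The eigenvalue equation makes the extension of `V` to a degree-one homogeneous map harmonic, and
harmonic maps of degree one are linear. -/
theorem exists_clm_of_mapLaplacian_eq {F : Type*} [NormedAddCommGroup F] [InnerProductSpace ℝ F]
    {V : M → F} (hV : ContMDiff (𝓡 m) 𝓘(ℝ, F) ∞ V) (hfac : V.FactorsThrough φ)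
    (heq : ∀ x, mapLaplacian g V x = -(energy g φ x • V x)) :
    ∃ A : Eucl (n + 1) →L[ℝ] F, ∀ x, V x = A (φ x : Eucl (n + 1)) := by
  let W : Eucl (n + 1) → F := fun q => ‖q‖ • radialDescent φ V q
  have hW : IsSmoothOffZero W := fun q hq =>
    (contDiffAt_norm ℝ hq).smul (isSmoothOffZero_radialDescent hφ.1 hsurj hsub hV hfac q hq)
  have hW₁ : IsHomogeneous 1 W := fun q _ r hr => by
    simp only [W, radialDescent_smul hr, norm_smul, Real.norm_of_nonneg hr.le, zpow_one, smul_smul]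
  have hWV : ∀ x, W (φ x : Eucl (n + 1)) = V x := fun x => by
    simp only [W, sphere_norm, one_smul, radialDescent_map hfac]
  have hharm : ∀ x, Δ W (φ x : Eucl (n + 1)) = 0 := fun x => by
    have h := (hconf x).mapLaplacian_comp_of_isHomogeneous hφ hW₁ hW
    have hn' : (n : ℝ) ≠ 0 := Nat.cast_ne_zero.2 (by omega)
    simp only [hWV, heq x, Int.cast_one, sub_self, zero_add, one_mul, smul_sub, smul_smul,
      div_mul_cancel₀ _ hn'] at h
    rw [eq_comm, sub_eq_neg_self] at h
    exact (smul_eq_zero.1 h).resolve_left (hφ.dilation_pos hn hsub x).ne'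
  have hharm' : ∀ q, q ≠ 0 → Δ W q = 0 := fun q hq => by
    obtain ⟨x, hx⟩ := exists_eq_smul_map hsurj hq
    rw [hx, hW₁.laplacian hW _ (sphere_ne_zero (φ x)) _ (norm_pos_iff.2 hq), hharm, smul_zero]
  obtain ⟨A, hA⟩ := exists_clm_of_laplacian_eq_zero
    (by simpa using Nat.succ_le_iff.1 hn) hW hW₁ hharm'
  exact ⟨A, fun x => by rw [← hWV, hA _ (sphere_ne_zero (φ x))]⟩

/-- Extended to a homogeneous function of degree zero, `u` becomes subharmonic. -/
theorem eq_of_mapLaplacian_nonneg {u : M → ℝ} (hu : ContMDiff (𝓡 m) 𝓘(ℝ, ℝ) ∞ u)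
    (hfac : u.FactorsThrough φ) (hΔ : ∀ x, 0 ≤ mapLaplacian g u x) (x x' : M) : u x = u x' := by
  let w : Eucl (n + 1) → ℝ := radialDescent φ u
  have hw : IsSmoothOffZero w := isSmoothOffZero_radialDescent hφ.1 hsurj hsub hu hfac
  have hw₀ : IsHomogeneous 0 w := isHomogeneous_radialDescent
  have hwu : ∀ x, w (φ x : Eucl (n + 1)) = u x := radialDescent_map hfac
  have hsubharm : ∀ x, 0 ≤ Δ w (φ x : Eucl (n + 1)) := fun x => by
    have h := (hconf x).mapLaplacian_comp_of_isHomogeneous hφ hw₀ hw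
    simp only [hwu, Int.cast_zero, zero_mul, sub_zero, smul_eq_mul] at h
    exact nonneg_of_mul_nonneg_right (h ▸ hΔ x) (hφ.dilation_pos hn hsub x)
  have hsubharm' : ∀ q, q ≠ 0 → 0 ≤ Δ w q := fun q hq => by
    obtain ⟨x, hx⟩ := exists_eq_smul_map hsurj hq
    rw [hx, hw₀.laplacian hw _ (sphere_ne_zero (φ x)) _ (norm_pos_iff.2 hq)]
    exact smul_nonneg (by positivity) (hsubharm x)
  rw [← hwu x, ← hwu x']
  exact eq_of_laplacian_eq_zero (by simpa using Nat.succ_le_iff.1 hn) hw hw₀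
    (fun q hq => laplacian_eq_zero_of_nonneg hw hw₀ hsubharm' hq)
    (sphere_ne_zero (φ x)) (sphere_ne_zero (φ x'))

end Eigenmaps

/-! ### One-parameter groups of rotations -/

section Rotations

open LieAlgebra.Orthogonal

variable {ι : Type*} [Fintype ι] [DecidableEq ι] {X : Matrix ι ι ℝ} {c : ℝ}

theorem eq_zero_of_inner_toEuclideanLin_self (hX : X.IsHermitian)
    (h : ∀ q, inner ℝ (Matrix.toEuclideanLin X q) q = 0) : X = 0 :=
  Matrix.toEuclideanLin.map_eq_zero_iff.1
    ((Matrix.isSymmetric_toEuclideanLin_iff.2 hX).inner_map_self_eq_zero.1 h)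

theorem inner_toEuclideanLin_transpose (X : Matrix ι ι ℝ) (p q : EuclideanSpace ℝ ι) :
    inner ℝ (Matrix.toEuclideanLin X.transpose p) q = inner ℝ p (Matrix.toEuclideanLin X q) := by
  rw [← Matrix.conjTranspose_eq_transpose_of_trivial,
    Matrix.toEuclideanLin_conjTranspose_eq_adjoint, LinearMap.adjoint_inner_left]

theorem mem_so_of_inner_toEuclideanLin_self
    (h : ∀ q, inner ℝ q (Matrix.toEuclideanLin X q) = 0) : X ∈ so ι ℝ := by
  have hsymm : X.transpose + X = 0 := by
    refine eq_zero_of_inner_toEuclideanLin_self (by simp [Matrix.IsHermitian, add_comm]) fun q => ?_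
    rw [map_add, LinearMap.add_apply, inner_add_left, inner_toEuclideanLin_transpose, h,
      real_inner_comm, h, add_zero]
  exact (mem_so _ _ _).2 (eq_neg_of_add_eq_zero_left hsymm)

theorem mul_self_of_norm_toEuclideanLin (hX : X ∈ so ι ℝ)
    (h : ∀ q, ‖Matrix.toEuclideanLin X q‖ = c * ‖q‖) : X * X = -(c ^ 2 • 1) := by
  have hsq : X.transpose * X - c ^ 2 • 1 = 0 := by
    refine eq_zero_of_inner_toEuclideanLin_self (by simp [Matrix.IsHermitian]) fun q => ?_
    rw [map_sub, LinearMap.sub_apply, inner_sub_left, Matrix.toLpLin_mul_same, LinearMap.comp_apply,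
      inner_toEuclideanLin_transpose, real_inner_self_eq_norm_sq, h, map_smul, Matrix.toLpLin_one,
      LinearMap.smul_apply, LinearMap.id_apply, real_inner_smul_left, real_inner_self_eq_norm_sq]
    ring
  rw [(mem_so _ _ _).1 hX, neg_mul] at hsq
  rw [← sub_eq_zero.1 hsq, neg_neg]

/-- The rotation `cos (c t) + (sin (c t) / c) X`, which is `exp (t X)` if `X` is skew-symmetric with
`X² = -c²`. The case `c = 0` is no exception, as then `X = 0`. -/
def rotationMatrix (X : Matrix ι ι ℝ) (c t : ℝ) : Matrix ι ι ℝ :=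
  Real.cos (c * t) • 1 + (Real.sin (c * t) / c) • X

theorem rotationMatrix_mul_transpose (hX : X ∈ so ι ℝ) (hX' : X * X = -(c ^ 2 • 1)) (t : ℝ) :
    rotationMatrix X c t * (rotationMatrix X c t).transpose = 1 := by
  rcases eq_or_ne c 0 with rfl | hc
  · simp [rotationMatrix]
  simp only [rotationMatrix, Matrix.transpose_add, Matrix.transpose_smul, Matrix.transpose_one,
    (mem_so _ _ _).1 hX, add_mul, mul_add, Matrix.smul_mul, Matrix.mul_smul, Matrix.one_mul,
    Matrix.mul_one, mul_neg, hX', smul_neg]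
  match_scalars
  · field_simp
    linear_combination Real.cos_sq_add_sin_sq (c * t)
  · ring

theorem rotationMatrix_add (hX' : X * X = -(c ^ 2 • 1)) (s t : ℝ) :
    rotationMatrix X c (s + t) = rotationMatrix X c s * rotationMatrix X c t := by
  rcases eq_or_ne c 0 with rfl | hc
  · simp [rotationMatrix]
  simp only [rotationMatrix, mul_add c, Real.cos_add, Real.sin_add, add_mul, mul_add,
    Matrix.smul_mul, Matrix.mul_smul, Matrix.one_mul, Matrix.mul_one, hX', smul_neg]
  match_scalars
  · field_simp
    ring
  · ring

/-- The one-parameter group generated by a skew-symmetric matrix `X` with `X² = -c²`. -/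
def rotationGroup (hX : X ∈ so ι ℝ) (hX' : X * X = -(c ^ 2 • 1)) :
    Multiplicative ℝ →ₜ* Matrix.orthogonalGroup ι ℝ where
  toFun t := ⟨rotationMatrix X c t.toAdd,
    (Matrix.mem_orthogonalGroup_iff _ _).2 (rotationMatrix_mul_transpose hX hX' _)⟩
  map_one' := Subtype.ext (by simp [rotationMatrix])
  map_mul' s t := Subtype.ext (rotationMatrix_add hX' s.toAdd t.toAdd)
  continuous_toFun := by
    have h : Continuous fun t : Multiplicative ℝ => t.toAdd := continuous_toAdd
    unfold rotationMatrix
    fun_prop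

end Rotations

/-! ### Infinitesimal and local rigidity -/

section Rigidity

open Filter Topology

variable {m n : ℕ} {M : Type*} [TopologicalSpace M] [ChartedSpace (Eucl m) M]
  [IsManifold (𝓡 m) ∞ M] {g : SmoothMetric m M} {φ : M → Sph n} {V : M → Eucl (n + 1)}

theorem exists_so_of_mapLaplacian_eq (hn : 1 ≤ n) (hφ : IsHarmonicMap g φ)
    (hconf : ∀ x, IsHorizontallyConformalAt g φ x (energy g φ x / n))
    (hsurj : Function.Surjective φ) (hsub : ∀ x, Function.Surjective (mfderiv (𝓡 m) (𝓡 n) φ x))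
    (hV : IsVectorFieldAlong m φ V) (hproj : IsProjectable φ V)
    (heq : ∀ x, mapLaplacian g V x = -(energy g φ x • V x)) :
    ∃ X ∈ LieAlgebra.Orthogonal.so (Fin (n + 1)) ℝ,
      ∀ x, V x = Matrix.toEuclideanLin X (φ x : Eucl (n + 1)) := by
  obtain ⟨A, hA⟩ := exists_clm_of_mapLaplacian_eq hn hφ hconf hsurj hsub hV.1
    (fun _ _ h => hproj _ _ h) heq
  refine ⟨Matrix.toEuclideanLin.symm A, mem_so_of_inner_toEuclideanLin_self fun q => ?_,
    fun x => by simpa using hA x⟩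
  rcases eq_or_ne q 0 with rfl | hq
  · exact inner_zero_left _
  obtain ⟨x, hx⟩ := exists_eq_smul_map hsurj hq
  rw [hx, map_smul, inner_smul_left, inner_smul_right, LinearEquiv.apply_symm_apply,
    ContinuousLinearMap.coe_coe, ← hA, hV.2, mul_zero, mul_zero]

namespace IsVectorFieldAlong

omit [IsManifold (𝓡 m) ∞ M] in
theorem contMDiffAt (hV : IsVectorFieldAlong m φ V) (x : M) {k : ℕ} :
    ContMDiffAt (𝓡 m) 𝓘(ℝ, Eucl (n + 1)) k V x :=
  (hV.1 x).of_le (WithTop.coe_le_coe.2 le_top)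

variable (hφ : ContMDiff (𝓡 m) (𝓡 n) ∞ φ) (hV : IsVectorFieldAlong m φ V) (x : M)
include hφ hV

theorem secondNabla_eq (u v : Eucl m) :
    secondNabla g φ V x u v =
      tangentProj (φ x : Eucl (n + 1)) (fderiv ℝ (fderiv ℝ (inChart x V)) (center x) u v
        - fderiv ℝ (inChart x V) (center x) (christoffel g x u v))
      + inner ℝ (V x) (mapDeriv φ x v (center x)) • mapDeriv φ x u (center x) := by
  have hΦ := (contDiffAt_inChart (contMDiffAt_coe hφ x (k := 1))).differentiableAt one_ne_zero
  have hV₂ := contDiffAt_inChart (hV.contMDiffAt x (k := 2))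
  have hnormal : inner ℝ (φ x : Eucl (n + 1)) (fderiv ℝ (inChart x V) (center x) v) =
      -inner ℝ (V x) (mapDeriv φ x v (center x)) := by
    have h := inner_fderiv_add_inner_fderiv hΦ (hV₂.differentiableAt two_ne_zero)
      (.of_forall fun y => hV.2 ((extChartAt (𝓡 m) x).symm y)) v
    rw [inChart_center, inChart_center] at h
    rw [real_inner_comm (mapDeriv φ x v (center x)), eq_neg_of_add_eq_zero_left h]
    rfl
  have hderiv := tangentPart_fderiv_tangentPart (u := u) hΦ
    ((differentiableAt_fderiv hV₂).clm_apply (differentiableAt_const v))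
    (by rw [inChart_center, sphere_inner_self])
    (by rw [inChart_center]; exact inner_mapDeriv hφ x u)
  rw [inChart_center, hnormal, fderiv_fderiv_apply hV₂, neg_smul, sub_neg_eq_add] at hderiv
  rw [secondNabla, pullbackNabla, inChart_center, map_sub]
  exact (congrArg (· - _) hderiv).trans (add_sub_right_comm _ _ _)

/-- The terms `⟨V, dφ(e_i)⟩ dφ(e_i)` of the second covariant derivative and of the curvature
cancel. -/
theorem jacobi_eq : jacobi g φ V x =
    -(tangentPart (φ x : Eucl (n + 1)) (mapLaplacian g V x) + energy g φ x • V x) := by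
  have hd := fun i => inner_mapDeriv hφ x (frame g x i)
  simp only [jacobi, hV.secondNabla_eq hφ, sphereCurvature_eq _ (hd _) (hV.2 x) (hd _),
    Finset.sum_add_distrib, Finset.sum_sub_distrib, ← Finset.sum_smul, ← map_sum,
    real_inner_self_eq_norm_sq]
  rw [neg_add' (tangentProj _ _), sub_sub_sub_cancel_right, ← neg_add']
  rfl

end IsVectorFieldAlong

theorem MemK.mapLaplacian_eq (hφ : IsHarmonicMap g φ) (hV : MemK g φ V) (x : M) :
    mapLaplacian g V x = -(energy g φ x • V x) := by
  have htrace : ∑ i, inner ℝ (frameDeriv g (fun z => (φ z : Eucl (n + 1))) x i)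
      (frameDeriv g V x i) = 0 := by
    rw [← hV.2 x]
    refine Finset.sum_congr rfl fun i _ => ?_
    rw [pullbackNabla, inChart_center, real_inner_comm (tangentPart _ _),
      inner_tangentPart (inner_mapDeriv hφ.1 x (frame g x i)), real_inner_comm]
    rfl
  have htangent : inner ℝ (φ x : Eucl (n + 1)) (mapLaplacian g V x) = 0 := by
    have h := inner_mapLaplacian_add g (contMDiffAt_coe hφ.1 x) (hV.1.1.contMDiffAt x)
      (.of_forall hV.1.1.2)
    rwa [htrace, hφ.mapLaplacian_eq, inner_neg_left, inner_smul_left, hV.1.1.2, mul_zero, mul_zero,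
      neg_zero, zero_add, zero_add] at h
  have hjacobi := hV.1.2 x
  rw [hV.1.1.jacobi_eq hφ.1, tangentPart_of_inner_eq_zero htangent, neg_eq_zero] at hjacobi
  exact eq_neg_of_add_eq_zero_left hjacobi

theorem isInfinitesimallyRigid (hn : 1 ≤ n) (hφ : IsHarmonicMap g φ)
    (hconf : ∀ x, IsHorizontallyConformalAt g φ x (energy g φ x / n))
    (hsurj : Function.Surjective φ) (hsub : ∀ x, Function.Surjective (mfderiv (𝓡 m) (𝓡 n) φ x)) :
    IsInfinitesimallyRigid g φ :=
  ⟨hφ, fun _ hproj hV => exists_so_of_mapLaplacian_eq hn hφ hconf hsurj hsub hV.1.1 hproj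
    (hV.mapLaplacian_eq hφ)⟩

section Variation

variable {W : Type*} [NormedAddCommGroup W] [InnerProductSpace ℝ W]

/-- At `θ = π` neither the derivative of `cos θ` nor that of `N` has a component along `N`. -/
theorem inner_mapLaplacian_cos_smul_add_sin_smul (g : SmoothMetric m M) {P N : M → W} {θ : M → ℝ}
    {x : M} (hP : ContMDiffAt (𝓡 m) 𝓘(ℝ, W) 2 P x) (hN : ContMDiffAt (𝓡 m) 𝓘(ℝ, W) 2 N x)
    (hθ : ContMDiffAt (𝓡 m) 𝓘(ℝ, ℝ) 2 θ x) (hθx : θ x = Real.pi)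
    (hunit : ∀ᶠ y in 𝓝 x, inner ℝ (N y) (N y) = 1) (hPN : inner ℝ (P x) (N x) = 0) :
    inner ℝ (mapLaplacian g (fun y => Real.cos (θ y) • P y + Real.sin (θ y) • N y) x) (N x) =
      -(inner ℝ (mapLaplacian g P x) (N x) + mapLaplacian g θ x) := by
  have hcos : ContMDiffAt (𝓡 m) 𝓘(ℝ, ℝ) 2 (fun y => Real.cos (θ y)) x :=
    Real.contDiff_cos.contMDiff.contMDiffAt.comp x hθ
  have hsin : ContMDiffAt (𝓡 m) 𝓘(ℝ, ℝ) 2 (fun y => Real.sin (θ y)) x :=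
    Real.contDiff_sin.contMDiff.contMDiffAt.comp x hθ
  have hdcos : ∀ i, frameDeriv g (fun y => Real.cos (θ y)) x i = 0 := fun i => by
    have h := ((contDiffAt_inChart hθ).differentiableAt two_ne_zero).hasFDerivAt.cos.fderiv
    rw [inChart_center, hθx, Real.sin_pi, neg_zero, zero_smul] at h
    exact congrArg (fun L : Eucl m →L[ℝ] ℝ => L (frame g x i)) h
  have hΔsin : mapLaplacian g (fun y => Real.sin (θ y)) x = -mapLaplacian g θ x := by
    rw [mapLaplacian_comp_of_hasDerivAt g (.of_forall Real.hasDerivAt_sin)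
      (Real.hasDerivAt_cos _) hθ, hθx, Real.sin_pi, Real.cos_pi, neg_zero, zero_mul, zero_add,
      neg_one_mul]
  have hdN : ∀ i, inner ℝ (frameDeriv g N x i) (N x) = 0 := fun i => by
    have h := inner_frameDeriv_add g (hN.of_le one_le_two) (hN.of_le one_le_two) hunit i
    rwa [real_inner_comm, add_self_eq_zero] at h
  rw [mapLaplacian_add g (f := fun y => Real.cos (θ y) • P y) (h := fun y => Real.sin (θ y) • N y)
    (hcos.smul hP) (hsin.smul hN), mapLaplacian_smul g hcos hP,
    mapLaplacian_smul g hsin hN, hΔsin, hθx, Real.cos_pi, Real.sin_pi]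
  simp only [hdcos, zero_smul, Finset.sum_const_zero, smul_zero, inner_add_left, inner_smul_left,
    sum_inner, hPN, hdN, hunit.self_of_nhds, mul_zero, mul_one, add_zero, zero_add, conj_trivial,
    neg_one_smul, inner_neg_left, neg_add]

end Variation

namespace IsHarmonicVariation

variable (hφ : IsHarmonicMap g φ) (hV : IsHarmonicVariation g φ V)
include hφ hV

/-- For `t = π / ‖V x‖` the deformation `exp(tV)` takes `x` to the antipode of `φ x`. -/
theorem mapLaplacian_norm_eq_zero {x : M} (hx : V x ≠ 0) :
    mapLaplacian g (fun y => ‖V y‖) x = 0 := by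
  have hx' : ‖V x‖ ≠ 0 := norm_ne_zero_iff.2 hx
  have hV₂ := hV.1.contMDiffAt x (k := 2)
  have hnorm : ContMDiffAt (𝓡 m) 𝓘(ℝ, ℝ) 2 (fun y => ‖V y‖) x :=
    (contDiffAt_norm ℝ hx).contMDiffAt.comp x hV₂
  set t := Real.pi / ‖V x‖ with ht
  have hθx : ‖V x‖ * t = Real.pi := mul_div_cancel₀ _ hx'
  let N : M → Eucl (n + 1) := fun y => ‖V y‖⁻¹ • V y
  have hunit : ∀ᶠ y in 𝓝 x, inner ℝ (N y) (N y) = 1 := by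
    filter_upwards [hV₂.continuousAt.eventually_ne hx] with y hy
    rw [real_inner_self_eq_norm_sq, norm_smul, norm_inv, norm_norm,
      inv_mul_cancel₀ (norm_ne_zero_iff.2 hy), one_pow]
  have hφN : ∀ y, inner ℝ (φ y : Eucl (n + 1)) (N y) = 0 := fun y => by
    rw [real_inner_smul_right, hV.1.2, mul_zero]
  have hexp : ∀ y, (expVariation φ V t y : Eucl (n + 1)) =
      Real.cos (‖V y‖ * t) • (φ y : Eucl (n + 1)) + Real.sin (‖V y‖ * t) • N y := fun y => by
    rw [expVariation_eq hV.1.2, greatCircle, smul_smul, div_eq_mul_inv]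
  have h := inner_mapLaplacian_cos_smul_add_sin_smul (N := N) (θ := fun y => ‖V y‖ * t) g
    (contMDiffAt_coe hφ.1 x) ((hnorm.inv₀ hx').smul hV₂) (hnorm.mul contMDiffAt_const) hθx hunit
    (hφN x)
  simp only [← hexp] at h
  rw [(hV.2 t).mapLaplacian_eq, hφ.mapLaplacian_eq, hexp, hθx, Real.cos_pi, Real.sin_pi] at h
  rw [mapLaplacian_comp_of_hasDerivAt (h := (· * t)) (h' := fun _ => t) g
    (.of_forall fun s => by simpa using (hasDerivAt_id s).mul_const t) (hasDerivAt_const _ t)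
    hnorm] at h
  simpa [inner_add_left, inner_smul_left, hφN, ht, hx, Real.pi_ne_zero] using h

theorem mapLaplacian_normSq_nonneg (x : M) :
    0 ≤ mapLaplacian g (fun y => ‖V y‖ ^ 2) x := by
  rcases eq_or_ne (V x) 0 with hx | hx
  · have h := mapLaplacian_inner g (hV.1.contMDiffAt x) (hV.1.contMDiffAt x)
    rw [hx, inner_zero_left, inner_zero_right, zero_add, add_zero] at h
    simp only [real_inner_self_eq_norm_sq] at h
    rw [h]
    positivity
  · have hnorm : ContMDiffAt (𝓡 m) 𝓘(ℝ, ℝ) 2 (fun y => ‖V y‖) x :=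
      (contDiffAt_norm ℝ hx).contMDiffAt.comp x (hV.1.contMDiffAt x)
    rw [mapLaplacian_comp_of_hasDerivAt (h := fun s => s ^ 2) (h' := fun s => 2 * s) g
      (.of_forall fun s => by simpa using hasDerivAt_pow 2 s)
      (by simpa using (hasDerivAt_id (‖V x‖)).const_mul 2) hnorm,
      hV.mapLaplacian_norm_eq_zero hφ hx, mul_zero, add_zero]
    positivity

theorem norm_eq (hn : 1 ≤ n)
    (hconf : ∀ x, IsHorizontallyConformalAt g φ x (energy g φ x / n))
    (hsurj : Function.Surjective φ) (hsub : ∀ x, Function.Surjective (mfderiv (𝓡 m) (𝓡 n) φ x))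
    (hproj : IsProjectable φ V) (x x' : M) : ‖V x‖ = ‖V x'‖ := by
  have h := eq_of_mapLaplacian_nonneg hn hφ hconf hsurj hsub
    ((contDiff_norm_sq ℝ).contMDiff.comp hV.1.1)
    (fun _ _ h => congrArg (‖·‖ ^ 2) (hproj _ _ h)) (hV.mapLaplacian_normSq_nonneg hφ) x x'
  exact (pow_left_inj₀ (norm_nonneg _) (norm_nonneg _) two_ne_zero).1 h

theorem cos_smul_mapLaplacian_add {c : ℝ} (hc : ∀ x, ‖V x‖ = c) (t : ℝ) (x : M) :
    Real.cos (c * t) • mapLaplacian g (fun y => (φ y : Eucl (n + 1))) x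
        + (Real.sin (c * t) / c) • mapLaplacian g V x =
      -(energy g (expVariation φ V t) x • (Real.cos (c * t) • (φ x : Eucl (n + 1))
        + (Real.sin (c * t) / c) • V x)) := by
  let A : Eucl (n + 1) →L[ℝ] Eucl (n + 1) := Real.cos (c * t) • .id ℝ _
  let B : Eucl (n + 1) →L[ℝ] Eucl (n + 1) := (Real.sin (c * t) / c) • .id ℝ _
  have hexp : ∀ y, (expVariation φ V t y : Eucl (n + 1)) = A (φ y) + B (V y) := fun y => by
    rw [expVariation_eq hV.1.2, greatCircle, hc]
    rfl
  have hφ₂ := contMDiffAt_coe hφ.1 x (k := 2)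
  have hV₂ := hV.1.contMDiffAt x (k := 2)
  have h := (hV.2 t).mapLaplacian_eq (x := x)
  simp only [hexp] at h
  rwa [mapLaplacian_add g (f := fun y => A (φ y)) (h := fun y => B (V y))
    (A.contMDiff.contMDiffAt.comp x hφ₂) (B.contMDiff.contMDiffAt.comp x hV₂),
    mapLaplacian_clm_comp g A hφ₂, mapLaplacian_clm_comp g B hV₂] at h

/-- At `t = π / 2` the deformation is `V / c`, so `V` solves the equation with some density in
place of the energy of `φ`; at `t = π / 4` it is a multiple of `φ + V / c`, so the densities of `φ`
and `V` agree. -/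
theorem mapLaplacian_eq_of_norm_eq {c : ℝ} (hc : ∀ x, ‖V x‖ = c) (x : M) :
    mapLaplacian g V x = -(energy g φ x • V x) := by
  rcases eq_or_ne c 0 with rfl | hc₀
  · have hV₀ : V = fun _ => 0 := funext fun y => norm_eq_zero.1 (hc y)
    rw [hV₀, mapLaplacian_const, smul_zero, neg_zero]
  have hVV : inner ℝ (V x) (V x) = c ^ 2 := by rw [real_inner_self_eq_norm_sq, hc]
  have hφV := hV.1.2 x
  have hhalf := hV.cos_smul_mapLaplacian_add hφ hc (Real.pi / 2 / c) x
  have hquarter := hV.cos_smul_mapLaplacian_add hφ hc (Real.pi / 4 / c) x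
  generalize energy g (expVariation φ V (Real.pi / 2 / c)) x = e₁ at hhalf
  generalize energy g (expVariation φ V (Real.pi / 4 / c)) x = e₂ at hquarter
  rw [mul_div_cancel₀ _ hc₀, Real.cos_pi_div_two, Real.sin_pi_div_two, zero_smul, zero_smul,
    zero_add, zero_add, smul_comm e₁, ← smul_neg] at hhalf
  replace hhalf := smul_right_injective _ (one_div_ne_zero hc₀) hhalf
  rw [mul_div_cancel₀ _ hc₀, Real.cos_pi_div_four, Real.sin_pi_div_four, hφ.mapLaplacian_eq,
    hhalf] at hquarter
  have h₁ := congrArg (inner ℝ (φ x : Eucl (n + 1))) hquarter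
  have h₂ := congrArg (inner ℝ (V x)) hquarter
  simp only [inner_add_right, inner_smul_right, inner_neg_right, hφV,
    real_inner_comm (φ x : Eucl (n + 1)), hVV, sphere_inner_self, mul_zero,
    mul_one, add_zero, zero_add, neg_zero] at h₁ h₂
  have hs : √2 / 2 ≠ 0 := by positivity
  have he₂ : e₂ = energy g φ x := mul_left_cancel₀ hs (by linear_combination h₁)
  have he₁ : e₂ = e₁ := mul_left_cancel₀ (a := √2 / 2 / c * c ^ 2) (by positivity)
    (by linear_combination h₂)
  rw [hhalf, ← he₁, he₂]

end IsHarmonicVariation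

theorem isLocallyRigid (hn : 1 ≤ n) (hφ : IsHarmonicMap g φ)
    (hconf : ∀ x, IsHorizontallyConformalAt g φ x (energy g φ x / n))
    (hsurj : Function.Surjective φ) (hsub : ∀ x, Function.Surjective (mfderiv (𝓡 m) (𝓡 n) φ x)) :
    IsLocallyRigid g φ := by
  refine ⟨hφ, fun V hproj hV => ?_⟩
  obtain ⟨c, hc⟩ : ∃ c, ∀ x, ‖V x‖ = c := by
    obtain ⟨x₀, -⟩ := hsurj ⟨EuclideanSpace.single 0 1, by simp⟩
    exact ⟨_, fun x => hV.norm_eq hφ hn hconf hsurj hsub hproj x x₀⟩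
  obtain ⟨X, hX, hVX⟩ := exists_so_of_mapLaplacian_eq hn hφ hconf hsurj hsub hV.1 hproj
    (hV.mapLaplacian_eq_of_norm_eq hφ hc)
  have hX' : X * X = -(c ^ 2 • 1) := mul_self_of_norm_toEuclideanLin hX fun q => by
    rcases eq_or_ne q 0 with rfl | hq
    · simp
    obtain ⟨x, hx⟩ := exists_eq_smul_map hsurj hq
    conv_lhs => rw [hx, map_smul, ← hVX, norm_smul, hc, norm_norm, mul_comm]
  refine ⟨rotationGroup hX hX', fun t x => ?_⟩
  change _ = Matrix.toEuclideanLin (rotationMatrix X c t) (φ x : Eucl (n + 1))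
  rw [expVariation_eq hV.1.2, greatCircle, hc, hVX, rotationMatrix, map_add, map_smul, map_smul,
    Matrix.toLpLin_one]
  rfl

end Rigidity

end SphereRigidity

end

theorem theorem3p4_general {m n : ℕ} (hn : 1 ≤ n) {M : Type*} [TopologicalSpace M]
    [ChartedSpace (EuclideanSpace ℝ (Fin m)) M] [IsManifold (𝓡 m) ∞ M]
    (g : SmoothMetric m M) (φ : M → Sph n)
    (hφ : IsHarmonicMorphism g (roundMetric n) φ)
    (hsurj : Function.Surjective φ)
    (hsub : ∀ x, Function.Surjective (mfderiv (𝓡 m) (𝓡 n) φ x)) :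
    IsInfinitesimallyRigid g φ ∧ IsLocallyRigid g φ :=
  have hconf := hφ.isHorizontallyConformalAt hn
  ⟨isInfinitesimallyRigid hn hφ.isHarmonicMap hconf hsurj hsub,
    isLocallyRigid hn hφ.isHarmonicMap hconf hsurj hsub⟩

theorem theorem3p4 {m n : ℕ} (hn : 1 ≤ n) {M : Type*} [TopologicalSpace M]
    [ChartedSpace (EuclideanSpace ℝ (Fin m)) M] [IsManifold (𝓡 m) ∞ M]
    (g : SmoothMetric m M) (φ : M → Sph n)
    (hφ : IsHarmonicMorphism g (roundMetric n) φ)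
    (hsurj : Function.Surjective φ)
    (hsub : ∀ x, Function.Surjective (mfderiv (𝓡 m) (𝓡 n) φ x)) :
    IsInfinitesimallyRigid g φ ∧ (Odd n → IsLocallyRigid g φ) :=
  have ⟨hinf, hloc⟩ := theorem3p4_general hn g φ hφ hsurj hsub
  ⟨hinf, fun _ => hloc⟩
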